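/- Let $k\ge 2$ and $n\ge 0$ be integers. For a commutative ring $R$ and $f\in R[x_1,\dots,x_k]$ put $$(\delta_2 f)(x_0,\dots,x_k)=f(x_1,x_2,x_3,\dots,x_k)-f(x_0+x_1,x_2,x_3,\dots,x_k)+f(x_0,x_1+x_2,x_3,\dots,x_k)-f(x_0,x_1,x_3,\dots,x_k),$$ and let $Z_k^n(R)$ be the $R$-module of symmetric polynomials $f\in R[x_1,\dots,x_k]$, homogeneous of degree $n$, with $\delta_2 f=0$ (the symmetric $2$-cocycles of degree $n$). Call $f\in Z_k^n(R)$ indecomposable if $f\neq 0$ and there is no division of the set of monomial symmetric polynomials of degree $n$ in $k$ variables into two disjoint classes $B_1,B_2$ such that $f=f_1+f_2$ with nonzero $f_1\in\operatorname{span}_R B_1$, $f_2\in\operatorname{span}_R B_2$ and $\delta_2f_1=\delta_2f_2=0$. Let $\zeta_k^n\in\mathbb Z[x_1,\dots,x_k]$ be the polynomial $$\sum_{\emptyset\ne I\subseteq\{1,\dots,k\}}(-1)^{|I|}\Big(\sum_{i\in I}x_i\Big)^n$$ divided by the greatest common divisor of its coefficients ($\zeta_k^n=0$ if this polynomial is $0$).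 For every prime $p$ let $(\beta_{p,i})_{i\in I_p}$ be a family in $\mathbb Z[x_1,\dots,x_k]$ whose reductions modulo $p$ list the indecomposable elements of $Z_k^n(\mathbb F_p)$, each exactly once up to a nonzero scalar. Then: 1. For every prime $p$, the reductions of the $\beta_{p,i}$ modulo $p$ form a basis of the $\mathbb F_p$-vector space $Z_k^n(\mathbb F_p)$; and $Z_k^n(\mathbb Q)$ is spanned by $\zeta_k^n$. 2. For every abelian group $A$ and every $f\in A\otimes\mathbb Z[x_1,\dots,x_k]$ that is homogeneous of degree $n$, invariant under permutations of the variables and satisfies $(\mathrm{id}_A\otimes\delta_2)f=0$, there are $b\in A$ and elements $c_{p,i}\in A$, only finitely many of them nonzero, with $p\,c_{p,i}=0$ for all $p$ and $i$, such that $$f=b\otimes\zeta_k^n+\sum_{p}\sum_{i\in I_p}c_{p,i}\otimes\beta_{p,i}.$$ -/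

import Mathlib

open MvPolynomial TensorProduct

noncomputable section

namespace SymmCocycle

/-- The coboundary map `δ₂` in `k` variables over `R`:
`(δ₂ f)(x₀, …, x_k) = f(x₁, x₂, x₃, …, x_k) - f(x₀ + x₁, x₂, x₃, …, x_k)
  + f(x₀, x₁ + x₂, x₃, …, x_k) - f(x₀, x₁, x₃, …, x_k)`.
The index `i : Fin k` stands for the variable `x_{i+1}` of `f`; in the target, `X i.castSucc` is
`x_i` and `X i.succ` is `x_{i+1}`. It is meant for `2 ≤ k`. -/
def delta (R : Type*) [CommRing R] (k : ℕ) :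
    MvPolynomial (Fin k) R →ₗ[R] MvPolynomial (Fin (k + 1)) R :=
  (aeval fun i : Fin k => (X i.succ : MvPolynomial (Fin (k + 1)) R)).toLinearMap
  - (aeval fun i : Fin k =>
      if i.val = 0 then (X i.castSucc + X i.succ : MvPolynomial (Fin (k + 1)) R)
      else X i.succ).toLinearMap
  + (aeval fun i : Fin k =>
      if i.val = 0 then (X i.castSucc : MvPolynomial (Fin (k + 1)) R)
      else if i.val = 1 then X i.castSucc + X i.succ
      else X i.succ).toLinearMap
  - (aeval fun i : Fin k =>
      if i.val < 2 then (X i.castSucc : MvPolynomial (Fin (k + 1)) R)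
      else X i.succ).toLinearMap

/-- The `R`-module of symmetric `2`-cocycles over `R` in `k` variables, homogeneous of
degree `n`. -/
def cocycles (R : Type*) [CommRing R] (k n : ℕ) : Submodule R (MvPolynomial (Fin k) R) :=
  Subalgebra.toSubmodule (symmetricSubalgebra (Fin k) R)
    ⊓ homogeneousSubmodule (Fin k) R n ⊓ LinearMap.ker (delta R k)

/-- An element of `A ⊗ ℤ[x₁, …, x_k]` is a symmetric `2`-cocycle, homogeneous of degree `n`:
it lies in `A ⊗ ℤ[x₁, …, x_k]_n`, is fixed by all permutations of the variables, and is killed by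
`id_A ⊗ δ₂`. -/
structure IsTensorCocycle (A : Type*) [AddCommGroup A] (k n : ℕ)
    (f : A ⊗[ℤ] MvPolynomial (Fin k) ℤ) : Prop where
  homogeneous :
    f ∈ LinearMap.range (LinearMap.lTensor A (homogeneousSubmodule (Fin k) ℤ n).subtype)
  symmetric : ∀ e : Equiv.Perm (Fin k),
    LinearMap.lTensor A (rename (R := ℤ) e).toLinearMap f = f
  cocycle : LinearMap.lTensor A (delta ℤ k) f = 0

/-- A homogeneous symmetric `2`-cocycle `f` is decomposable if the monomial symmetric
polynomials of degree `n` can be divided into two classes in such a way that `f` is a sum of two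
nonzero cocycles, one in the span of each class. (Monomial symmetric polynomials of partitions
with more than `k` parts are zero.) -/
def IsDecomposable (R : Type*) [CommRing R] (k n : ℕ) (f : MvPolynomial (Fin k) R) : Prop :=
  ∃ S : Set n.Partition,
    ∃ f₁ ∈ Submodule.span R (msymm (Fin k) R '' S),
    ∃ f₂ ∈ Submodule.span R (msymm (Fin k) R '' Sᶜ),
      f₁ ≠ 0 ∧ f₂ ≠ 0 ∧ delta R k f₁ = 0 ∧ delta R k f₂ = 0 ∧ f₁ + f₂ = f

/-- Indecomposable cocycles: nonzero homogeneous symmetric `2`-cocycles that are not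
decomposable. -/
def IsIndecomposable (R : Type*) [CommRing R] (k n : ℕ) (f : MvPolynomial (Fin k) R) : Prop :=
  f ∈ cocycles R k n ∧ f ≠ 0 ∧ ¬ IsDecomposable R k n f

/-- The family `β` lists the indecomposable cocycles in `k` variables and degree `n` over `R`,
each exactly once up to multiplication by a unit. -/
def ListsIndecomposables (R : Type*) [CommRing R] (k n : ℕ) {ι : Type*}
    (β : ι → MvPolynomial (Fin k) R) : Prop :=
  (∀ i, IsIndecomposable R k n (β i)) ∧
    ∀ g, IsIndecomposable R k n g → ∃! i, ∃ u : Rˣ, g = (u : R) • β i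

/-- `∑_{∅ ≠ I ⊆ {1, …, k}} (-1)^{|I|} (∑_{i ∈ I} x_i)^n`. -/
def zetaSum (k n : ℕ) : MvPolynomial (Fin k) ℤ :=
  ∑ I ∈ (Finset.univ : Finset (Finset (Fin k))).erase ∅,
    (-1) ^ I.card * (∑ i ∈ I, X i) ^ n

/-- `ζ_k^n`: the polynomial `zetaSum k n` divided by the gcd of its coefficients (and `0` when
that polynomial is `0`). -/
def zeta (k n : ℕ) : MvPolynomial (Fin k) ℤ :=
  ∑ m ∈ (zetaSum k n).support,
    monomial m ((zetaSum k n).coeff m / (zetaSum k n).support.gcd (zetaSum k n).coeff)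

end SymmCocycle

end

/-! A symmetric cocycle with coefficients in an abelian group `A` is a function `c` of exponents.
Comparing coefficients turns the cocycle condition into relations with two terms
(`lcoeff_comp_delta`). They kill every nonconstant monomial that misses a variable. On the others,
extend `c` multilinearly to the divided power ring, where `γ_u γ_v = (u+v choose u) γ_{u+v}`; the
relations then say `c(γ_u γ_v, γ_w, …) = c(γ_u, γ_v γ_w, …)`.

Fix a prime `p` and put `y_i = (p^i)! / p^(geomExp p i) • γ_{p^i}`, so that `y_i^p = p y_{i+1}`; up
to factors prime to `p`, each `γ_u` is a product of these. Factors move freely between the `k`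
slots, so on products of the `y_i` the function `c` depends only on the total multiset `D` of
indices. Call the value `h D`. Trading `p` copies of `i` for one `i + 1` costs a factor `p`, and it
follows that `p • h D` depends only on the weight and the size of `D`, in a way that is the same for
all cocycles up to scale. So for an integral cocycle `z` the difference `z b • c a - z a • c b` is
killed by `l * p` with `l` prime to `p` (`IsCoc.exists_coprime`).

Over `ℚ` this makes every cocycle a multiple of `ζ`. For general `A`, the coefficients of a nonzero
`ζ` have gcd one, and a Bezout combination `b` of the coefficients of `f` makes `f - b ⊗ ζ` a
cocycle killed by a squarefree number. It splits into cocycles killed by single primes `p`. Their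
coefficients lie in the `𝔽_p`-vector space `A[p]`, and coordinates in a basis reduce them to
cocycles over `𝔽_p`.

Over a field, relations with two terms allow a cocycle to be cut along classes of linked monomials,
and the cocycles supported in one class are proportional. The indecomposable cocycles are exactly
the nonzero pieces, whence the basis (`ListsIndecomposables.basis`). -/

namespace SymmCocycle

/-! ### Arithmetic of products of rescaled divided powers. -/

/-- The exponent of `p` in `(p ^ i)!`. -/
def geomExp (p i : ℕ) : ℕ := ∑ j ∈ Finset.range i, p ^ j

/-- The sum of the powers `p ^ i`, for `i` in the multiset `D`. -/
def wt (p : ℕ) (D : Multiset ℕ) : ℕ := (D.map (p ^ ·)).sum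

/-- The exponent of `p` in the product of the factorials `(p ^ i)!`, for `i` in `D`. -/
def expo (p : ℕ) (D : Multiset ℕ) : ℕ := (D.map (geomExp p)).sum

/-- The coefficient of the divided power `γ_{wt p D}` in the product of the rescaled divided
powers `(p ^ i)! / p ^ geomExp p i • γ_{p ^ i}`, for `i` in `D`. -/
def dpow (p : ℕ) (D : Multiset ℕ) : ℕ := (wt p D).factorial / p ^ expo p D

section

variable {p : ℕ}

@[simp] theorem wt_zero : wt p 0 = 0 := rfl

@[simp] theorem wt_cons (i : ℕ) (D : Multiset ℕ) : wt p (i ::ₘ D) = p ^ i + wt p D := by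
  simp [wt]

@[simp] theorem wt_add (D D' : Multiset ℕ) : wt p (D + D') = wt p D + wt p D' := by
  simp [wt]

@[simp] theorem wt_replicate (i j : ℕ) : wt p (Multiset.replicate j i) = j * p ^ i := by
  simp [wt]

@[simp] theorem expo_zero : expo p 0 = 0 := rfl

@[simp] theorem expo_cons (i : ℕ) (D : Multiset ℕ) :
    expo p (i ::ₘ D) = geomExp p i + expo p D := by
  simp [expo]

@[simp] theorem expo_add (D D' : Multiset ℕ) : expo p (D + D') = expo p D + expo p D' := by
  simp [expo]

@[simp] theorem expo_replicate (i j : ℕ) : expo p (Multiset.replicate j i) = j * geomExp p i := by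
  simp [expo]

theorem geomExp_succ (i : ℕ) : geomExp p (i + 1) = p ^ i + geomExp p i := by
  simp [geomExp, Finset.sum_range_succ, add_comm]

theorem geomExp_succ' (i : ℕ) : geomExp p (i + 1) = p * geomExp p i + 1 := by
  simp [geomExp, Finset.sum_range_succ', pow_succ', Finset.mul_sum]

theorem wt_map_succ (D : Multiset ℕ) : wt p (D.map (· + 1)) = p * wt p D := by
  induction D using Multiset.induction_on with
  | empty => simp
  | cons i D ih => simp [ih, pow_succ', mul_add]

theorem expo_map_succ (D : Multiset ℕ) : expo p (D.map (· + 1)) = wt p D + expo p D := by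
  induction D using Multiset.induction_on with
  | empty => simp
  | cons i D ih => simp [ih, geomExp_succ]; ring

theorem exists_map_succ (D : Multiset ℕ) :
    ∃ E : Multiset ℕ, D = Multiset.replicate (D.count 0) 0 + E.map (· + 1) := by
  induction D using Multiset.induction_on with
  | empty => exact ⟨0, by simp⟩
  | cons i D ih =>
    obtain ⟨E, hE⟩ := ih
    rcases i with _ | i
    · exact ⟨E, by rw [Multiset.count_cons_self, Multiset.replicate_succ, Multiset.cons_add, ← hE]⟩
    · refine ⟨i ::ₘ E, ?_⟩
      rw [Multiset.count_cons_of_ne (by simp), Multiset.map_cons, Multiset.add_cons, ← hE]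

theorem wt_modEq_count (D : Multiset ℕ) : D.count 0 ≡ wt p D [MOD p] := by
  obtain ⟨E, hE⟩ := exists_map_succ D
  conv_rhs => rw [hE, wt_add, wt_replicate, wt_map_succ, pow_zero, mul_one]
  exact (Nat.modEq_iff_dvd' (Nat.le_add_right _ _)).2 (by simp)

theorem card_le_wt (hp : 0 < p) (D : Multiset ℕ) : Multiset.card D ≤ wt p D := by
  induction D using Multiset.induction_on with
  | empty => simp
  | cons i D ih => have := Nat.pow_pos (n := i) hp; simp; omega

theorem wt_pos (hp : 0 < p) {D : Multiset ℕ} (hD : D ≠ 0) : 0 < wt p D :=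
  (Multiset.card_pos.2 hD).trans_le (card_le_wt hp D)

theorem padicValNat_factorial_pow [Fact p.Prime] (i : ℕ) :
    padicValNat p (p ^ i).factorial = geomExp p i := by
  induction i with
  | zero => simp [geomExp]
  | succ i ih => rw [pow_succ', padicValNat_factorial_mul, ih, geomExp_succ, add_comm]

theorem pow_expo_dvd [Fact p.Prime] (D : Multiset ℕ) : p ^ expo p D ∣ (wt p D).factorial := by
  induction D using Multiset.induction_on with
  | empty => simp
  | cons i D ih =>
    rw [expo_cons, wt_cons, pow_add]
    refine (mul_dvd_mul ?_ ih).trans (Nat.factorial_mul_factorial_dvd_factorial_add _ _)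
    rw [← padicValNat_factorial_pow]
    exact pow_padicValNat_dvd

theorem dpow_mul [Fact p.Prime] (D : Multiset ℕ) :
    dpow p D * p ^ expo p D = (wt p D).factorial :=
  Nat.div_mul_cancel (pow_expo_dvd D)

/-- The binomial coefficient is the structure constant of `γ_a γ_b = (a+b choose a) γ_{a+b}`. -/
theorem dpow_add [hp : Fact p.Prime] (D D' : Multiset ℕ) :
    dpow p (D + D') = (wt p D + wt p D').choose (wt p D) * (dpow p D * dpow p D') := by
  have h := dpow_mul (p := p) (D + D')
  rw [wt_add, ← Nat.add_choose_mul_factorial_mul_factorial, ← dpow_mul, ← dpow_mul, expo_add,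
    pow_add] at h
  rw [Nat.choose_symm_add]
  have h0 : 0 < p ^ expo p D * p ^ expo p D' := by
    have := hp.out.pos
    positivity
  refine Nat.eq_of_mul_eq_mul_right h0 (h.trans ?_)
  ring

/-- This is `y_i ^ p = p y_{i+1}`, which comes from `geomExp p (i + 1) = p * geomExp p i + 1`. -/
theorem dpow_replicate_add [hp : Fact p.Prime] (i : ℕ) (D : Multiset ℕ) :
    dpow p (Multiset.replicate p i + D) = p * dpow p ((i + 1) ::ₘ D) := by
  have h := dpow_mul (p := p) (Multiset.replicate p i + D)
  have h' := dpow_mul (p := p) ((i + 1) ::ₘ D)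
  simp only [wt_add, wt_replicate, wt_cons, expo_add, expo_replicate, expo_cons, geomExp_succ',
    ← pow_succ'] at h h'
  rw [← h'] at h
  have h0 : 0 < p ^ (p * geomExp p i + expo p D) := Nat.pow_pos hp.out.pos
  refine Nat.eq_of_mul_eq_mul_right h0 (h.trans ?_)
  ring

/-- The multiset of base `p` digits of `x` works, by Legendre's formula. -/
theorem exists_wt_expo_eq [hp : Fact p.Prime] (x : ℕ) :
    ∃ D, wt p D = x ∧ expo p D = padicValNat p x.factorial := by
  induction x using Nat.strong_induction_on with
  | _ x ih =>
    rcases Nat.eq_zero_or_pos x with rfl | hx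
    · exact ⟨0, by simp⟩
    · obtain ⟨D, hD, hD'⟩ := ih (x / p) (Nat.div_lt_self hx hp.out.one_lt)
      refine ⟨D.map (· + 1) + Multiset.replicate (x % p) 0, ?_, ?_⟩
      · rw [wt_add, wt_map_succ, wt_replicate, hD, pow_zero, mul_one, Nat.div_add_mod]
      · rw [expo_add, expo_map_succ, expo_replicate, hD, hD', ← Nat.div_add_mod x p,
          padicValNat_factorial_mul_add _ (Nat.mod_lt _ hp.out.pos), padicValNat_factorial_mul,
          Nat.div_add_mod]
        simp [geomExp, add_comm]

theorem exists_dpow_coprime [hp : Fact p.Prime] {x : ℕ} (hx : 0 < x) :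
    ∃ D, D ≠ 0 ∧ wt p D = x ∧ (dpow p D).Coprime p := by
  obtain ⟨D, rfl, hD⟩ := exists_wt_expo_eq (p := p) x
  refine ⟨D, ?_, rfl, ?_⟩
  · rintro rfl
    simp at hx
  · rw [Nat.coprime_comm, hp.out.coprime_iff_not_dvd, dpow, hD]
    exact Nat.factorization_def _ hp.out ▸ Nat.not_dvd_ordCompl hp.out (Nat.factorial_ne_zero _)

end

/-! ### Distributing a multiset over `k` nonempty slots. -/

/-- A function on multisets that allows to move a part of one member to another one depends only
on the sum of the multiset. -/
theorem eq_of_sum_eq {α A : Type*} (k : ℕ) (H : Multiset (Multiset α) → A)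
    (hH : ∀ a b d W, a ≠ 0 → b ≠ 0 → d ≠ 0 → 0 ∉ W → Multiset.card W + 2 = k →
      H ((a + b) ::ₘ d ::ₘ W) = H (a ::ₘ (b + d) ::ₘ W))
    (W W' : Multiset (Multiset α)) (hk : Multiset.card W = k) (hk' : Multiset.card W' = k)
    (hW : 0 ∉ W) (hW' : 0 ∉ W') (h : W.sum = W'.sum) : H W = H W' := by
  induction k generalizing H W W' with
  | zero => rw [Multiset.card_eq_zero.1 hk, Multiset.card_eq_zero.1 hk']
  | succ k ih =>
    rcases k with _ | k
    · obtain ⟨a, rfl⟩ := Multiset.card_eq_one.1 hk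
      obtain ⟨b, rfl⟩ := Multiset.card_eq_one.1 hk'
      rw [Multiset.sum_singleton, Multiset.sum_singleton] at h
      rw [h]
    -- Isolate `y` in a slot of its own by moving its companions to another slot. Doing so for the
    -- same `y` in `W` and `W'` leaves one slot fewer.
    have key : ∀ (V : Multiset (Multiset α)) (y : α), Multiset.card V = k + 1 + 1 → 0 ∉ V →
        y ∈ V.sum → ∃ U, Multiset.card U = k + 1 ∧ 0 ∉ U ∧ {y} + U.sum = V.sum ∧
          H V = H ({y} ::ₘ U) := by
      intro V y hV hV0 hy
      obtain ⟨w, hw, hyw⟩ := Multiset.mem_join.1 hy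
      obtain ⟨V, rfl⟩ := Multiset.exists_cons_of_mem hw
      obtain ⟨w, rfl⟩ := Multiset.exists_cons_of_mem hyw
      rw [Multiset.card_cons, add_left_inj] at hV
      by_cases hw0 : w = 0
      · subst hw0
        exact ⟨V, hV, fun h => hV0 (Multiset.mem_cons_of_mem h), by simp, rfl⟩
      · obtain ⟨d, hd⟩ := Multiset.card_pos_iff_exists_mem.1 (by omega : 0 < Multiset.card V)
        obtain ⟨V, rfl⟩ := Multiset.exists_cons_of_mem hd
        simp only [Multiset.mem_cons, not_or] at hV0
        rw [Multiset.card_cons] at hV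
        refine ⟨(w + d) ::ₘ V, by simpa using hV, ?_, by simp [add_assoc], ?_⟩
        · simp only [Multiset.mem_cons, not_or]
          exact ⟨fun h => hw0 (add_eq_zero.1 h.symm).1, hV0.2.2⟩
        · rw [← Multiset.singleton_add]
          exact hH _ _ _ _ (Multiset.singleton_ne_zero y) hw0 (Ne.symm hV0.2.1) hV0.2.2 (by omega)
    obtain ⟨w, hw⟩ := Multiset.card_pos_iff_exists_mem.1 (by omega : 0 < Multiset.card W)
    obtain ⟨y, hy⟩ := Multiset.exists_mem_of_ne_zero (ne_of_mem_of_not_mem hw hW : w ≠ 0)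
    have hyW : y ∈ W.sum := Multiset.mem_join.2 ⟨w, hw, hy⟩
    obtain ⟨U, hU, hU0, hUs, e⟩ := key W y hk hW hyW
    obtain ⟨U', hU', hU0', hUs', e'⟩ := key W' y hk' hW' (h ▸ hyW)
    rw [e, e']
    refine ih (fun U => H ({y} ::ₘ U)) ?_ U U' hU hU' hU0 hU0'
      (add_left_cancel (hUs.trans (h.trans hUs'.symm)))
    intro a b d V ha hb hd hV0 hV
    have := hH a b d ({y} ::ₘ V) ha hb hd (by simpa using hV0) (by simp; omega)
    rwa [Multiset.cons_swap d, Multiset.cons_swap (a + b), Multiset.cons_swap (b + d),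
      Multiset.cons_swap a] at this

theorem card_le_card_sum {α : Type*} {W : Multiset (Multiset α)} (hW : 0 ∉ W) :
    Multiset.card W ≤ Multiset.card W.sum := by
  induction W using Multiset.induction_on with
  | empty => simp
  | cons w W ih =>
    simp only [Multiset.mem_cons, not_or] at hW
    have h1 := ih hW.2
    have h2 := Multiset.card_pos.2 (Ne.symm hW.1)
    rw [Multiset.card_cons, Multiset.sum_cons, Multiset.card_add]
    omega

theorem exists_sum_eq {α : Type*} (k : ℕ) (D : Multiset α) (hk : 0 < k)
    (hD : k ≤ Multiset.card D) :
    ∃ W : Multiset (Multiset α), Multiset.card W = k ∧ 0 ∉ W ∧ W.sum = D := by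
  induction k, hk using Nat.le_induction generalizing D with
  | base =>
    refine ⟨{D}, by simp, ?_, by simp⟩
    rw [Multiset.mem_singleton]
    rintro rfl
    simp at hD
  | succ k hk ih =>
    obtain ⟨y, hy⟩ := Multiset.card_pos_iff_exists_mem.1 ((Nat.succ_pos k).trans_le hD)
    obtain ⟨D, rfl⟩ := Multiset.exists_cons_of_mem hy
    obtain ⟨W, hW, hW0, rfl⟩ := ih D (by simpa using hD)
    exact ⟨{y} ::ₘ W, by simp [hW], by simp [hW0], by simp⟩

/-! ### Comparing two cocycles at a prime `p`. -/

/-- The relations between the coefficients of a symmetric `2`-cocycle in `k` variables, at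
monomials in which all variables occur. -/
def IsBinomial {A : Type*} [AddCommGroup A] (k : ℕ) (c : Multiset ℕ → A) : Prop :=
  ∀ u v w a, 0 < u → 0 < v → 0 < w → 0 ∉ a → Multiset.card a + 2 = k →
    (u + v).choose u • c ((u + v) ::ₘ w ::ₘ a) = (v + w).choose v • c (u ::ₘ (v + w) ::ₘ a)

/-- The value of the multilinear extension of `c` at products of rescaled divided powers. -/
def pullback {A : Type*} [AddCommGroup A] (p : ℕ) (c : Multiset ℕ → A)
    (W : Multiset (Multiset ℕ)) : A :=
  (W.map (dpow p)).prod • c (W.map (wt p))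

section

variable {A : Type*} [AddCommGroup A] {p k : ℕ} [hp : Fact p.Prime]

theorem IsBinomial.pullback_eq {c : Multiset ℕ → A} (hc : IsBinomial k c)
    (a b d : Multiset ℕ) (W : Multiset (Multiset ℕ)) (ha : a ≠ 0) (hb : b ≠ 0) (hd : d ≠ 0)
    (hW : 0 ∉ W) (hk : Multiset.card W + 2 = k) :
    pullback p c ((a + b) ::ₘ d ::ₘ W) = pullback p c (a ::ₘ (b + d) ::ₘ W) := by
  have hp0 := hp.out.pos
  have h := hc _ _ _ (W.map (wt p)) (wt_pos hp0 ha) (wt_pos hp0 hb) (wt_pos hp0 hd)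
    (by
      simp only [Multiset.mem_map, not_exists, not_and]
      exact fun w hw => (wt_pos hp0 (ne_of_mem_of_not_mem hw hW)).ne') (by simpa using hk)
  have h' := congrArg (fun x =>
    (dpow p a * dpow p b * dpow p d * (W.map (dpow p)).prod) • x) h
  simp only [smul_smul] at h'
  simp only [pullback, Multiset.map_cons, Multiset.prod_cons, dpow_add, wt_add]
  convert h' using 2 <;> ring

/-- The value does not depend on the slots, by `eq_of_sum_eq`. The second property is `y_i ^ p = p
y_{i+1}` inside one slot; its size condition ensures that `(i + 1) ::ₘ D` fills `k` slots. -/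
theorem IsBinomial.exists_descent {c : Multiset ℕ → A} (hc : IsBinomial k c) (hk : 0 < k) :
    ∃ h : Multiset ℕ → A,
      (∀ W, Multiset.card W = k → 0 ∉ W → h W.sum = pullback p c W) ∧
      ∀ i D, k ≤ Multiset.card D + 1 →
        h (Multiset.replicate p i + D) = p • h ((i + 1) ::ₘ D) := by
  classical
  let h : Multiset ℕ → A := fun D =>
    if hD : k ≤ Multiset.card D then pullback p c (exists_sum_eq k D hk hD).choose else 0
  have spec : ∀ W, Multiset.card W = k → 0 ∉ W → h W.sum = pullback p c W := by
    intro W hW hW0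
    have hD : k ≤ Multiset.card W.sum := hW ▸ card_le_card_sum hW0
    obtain ⟨h1, h2, h3⟩ := (exists_sum_eq k W.sum hk hD).choose_spec
    simp only [h, dif_pos hD]
    exact eq_of_sum_eq k _ hc.pullback_eq _ _ h1 hW h2 hW0 h3
  refine ⟨h, spec, fun i D hD => ?_⟩
  obtain ⟨W, hW, hW0, hWs⟩ := exists_sum_eq k ((i + 1) ::ₘ D) hk (by simpa using hD)
  obtain ⟨w, hw, hiw⟩ := Multiset.mem_join.1
    (show i + 1 ∈ W.sum from hWs ▸ Multiset.mem_cons_self _ _)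
  obtain ⟨W, rfl⟩ := Multiset.exists_cons_of_mem hw
  obtain ⟨w, rfl⟩ := Multiset.exists_cons_of_mem hiw
  have h1 := spec _ hW hW0
  simp only [Multiset.mem_cons, not_or] at hW0
  have h2 := spec ((Multiset.replicate p i + w) ::ₘ W) (by simpa using hW) (by
    simp only [Multiset.mem_cons, not_or]
    refine ⟨fun h => hp.out.ne_zero ?_, hW0.2⟩
    simpa using congrArg Multiset.card (add_eq_zero.1 h.symm).1)
  rw [hWs] at h1
  have hs : ((Multiset.replicate p i + w) ::ₘ W).sum = Multiset.replicate p i + D := by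
    rw [Multiset.sum_cons, Multiset.cons_add, Multiset.cons_inj_right] at hWs
    rw [Multiset.sum_cons, add_assoc, hWs]
  rw [hs] at h2
  rw [h1, h2]
  simp only [pullback, Multiset.map_cons, Multiset.prod_cons, dpow_replicate_add, smul_smul,
    wt_add, wt_replicate, wt_cons, mul_assoc, pow_succ']

/-- Functions of multisets of powers of `p` as in `IsBinomial.exists_descent`. -/
def IsDescent (p k : ℕ) (h : Multiset ℕ → A) : Prop :=
  ∀ i D, k ≤ Multiset.card D + 1 → h (Multiset.replicate p i + D) = p • h ((i + 1) ::ₘ D)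

/-- The exchange replaces `i + 2` and `p` zeros by `p` copies of `i + 1` and a single `1`. It
preserves weight and size and removes `p` zeros. -/
theorem IsDescent.exists_count_lt {h : Multiset ℕ → A} (hh : IsDescent p k h) {D D' : Multiset ℕ}
    (hk : k ≤ Multiset.card D) (hcard : Multiset.card D = Multiset.card D')
    (hwt : wt p D = wt p D') (hlt : D'.count 0 < D.count 0) :
    ∃ E, Multiset.card E = Multiset.card D ∧ wt p E = wt p D ∧ E.count 0 < D.count 0 ∧
      p • h E = p • h D := by
  have hp1 := hp.out.one_lt
  have hmod : D'.count 0 ≡ D.count 0 [MOD p] :=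
    (wt_modEq_count D').trans (hwt ▸ (wt_modEq_count D).symm)
  -- If `D` had only indices 0 and 1, then `D'`, of the same size with fewer zeros, would have
  -- larger weight.
  obtain ⟨i, hi⟩ : ∃ i, i + 2 ∈ D := by
    by_contra hno
    push Not at hno
    obtain ⟨E, hE⟩ := exists_map_succ D
    obtain ⟨E', hE'⟩ := exists_map_succ D'
    have hE0 : wt p E = Multiset.card E := by
      have : ∀ j ∈ E, j = 0 := by
        intro j hj
        by_contra hj0
        obtain ⟨j, rfl⟩ := Nat.exists_eq_succ_of_ne_zero hj0
        exact hno j (hE ▸ Multiset.mem_add.2 (Or.inr (Multiset.mem_map_of_mem _ hj)))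
      rw [Multiset.eq_replicate_card.2 this]
      simp
    have hE1 := card_le_wt hp.out.pos E'
    have c1 : Multiset.card D = D.count 0 + Multiset.card E := by
      conv_lhs => rw [hE]
      simp
    have c2 : Multiset.card D' = D'.count 0 + Multiset.card E' := by
      conv_lhs => rw [hE']
      simp
    have w1 : wt p D = D.count 0 + p * wt p E := by
      conv_lhs => rw [hE, wt_add, wt_map_succ]
      simp
    have w2 : wt p D' = D'.count 0 + p * wt p E' := by
      conv_lhs => rw [hE', wt_add, wt_map_succ]
      simp
    have := Nat.mul_le_mul_left p hE1
    rw [w1, w2, hE0] at hwt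
    obtain ⟨t, ht⟩ := Nat.exists_eq_add_of_lt hlt
    have h3 : Multiset.card E' = Multiset.card E + (t + 1) := by omega
    rw [h3, mul_add] at this
    have := Nat.mul_lt_mul_of_pos_right hp1 (Nat.succ_pos t)
    simp only [Nat.succ_eq_add_one] at this
    omega
  obtain ⟨D₂, rfl⟩ := Multiset.exists_cons_of_mem hi
  rw [Multiset.count_cons_of_ne (by simp)] at hlt hmod ⊢
  have hle : p ≤ D₂.count 0 := by
    have := Nat.le_of_dvd (by omega) ((Nat.modEq_iff_dvd' hlt.le).1 hmod)
    omega
  obtain ⟨D₃, rfl⟩ := Multiset.le_iff_exists_add.1 (Multiset.le_count_iff_replicate_le.1 hle)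
  refine ⟨1 ::ₘ (Multiset.replicate p (i + 1) + D₃), ?_, ?_, ?_, ?_⟩
  · simp
  · simp [pow_succ']; ring
  · simp [Multiset.count_replicate, hp.out.pos]
  -- Both sides unfold to the value at the common refinement with `p` zeros and `p` copies of `i +
  -- 1`; this uses up the factor `p`.
  · rw [← hh (i + 1), ← hh 0]
    · congr 1
      abel
    · simp at hk ⊢; omega
    · simpa using hk

/-- Exchanges equalize the numbers of zeros. Then the common zeros are absorbed into `h` and all
remaining indices are lowered by one, which decreases the weight. -/
theorem IsDescent.smul_eq_smul {h : Multiset ℕ → A} (hh : IsDescent p k h) (D D' : Multiset ℕ)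
    (hk : k ≤ Multiset.card D) (hcard : Multiset.card D = Multiset.card D')
    (hwt : wt p D = wt p D') : p • h D = p • h D' := by
  induction hn : wt p D using Nat.strong_induction_on generalizing h k D D' with
  | _ n ihn =>
  induction hs : D.count 0 + D'.count 0 using Nat.strong_induction_on generalizing D D' with
  | _ s ihs =>
  rcases lt_trichotomy (D.count 0) (D'.count 0) with hlt | heq | hlt
  · obtain ⟨E, h1, h2, h3, h4⟩ :=
      hh.exists_count_lt (hcard ▸ hk) hcard.symm hwt.symm hlt
    rw [← h4]
    exact ihs _ (by omega) D E hk (hcard.trans h1.symm) (hwt.trans h2.symm) hn rfl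
  · rcases eq_or_ne D 0 with rfl | hD
    · rw [Multiset.card_zero, eq_comm, Multiset.card_eq_zero] at hcard
      rw [hcard]
    obtain ⟨E, hE⟩ := exists_map_succ D
    obtain ⟨E', hE'⟩ := exists_map_succ D'
    rw [← heq] at hE'
    generalize D.count 0 = m at hE hE'
    subst hE hE'
    have hw : wt p E = wt p E' := by
      simp only [wt_add, wt_map_succ, add_right_inj] at hwt
      exact Nat.eq_of_mul_eq_mul_left hp.out.pos hwt
    refine ihn (wt p E) ?_ (k := k - m)
      (h := fun E => h (Multiset.replicate m 0 + E.map (· + 1))) ?_ E E' ?_ ?_ hw rfl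
    · rw [← hn, wt_add, wt_map_succ, wt_replicate]
      by_cases hE0 : E = 0
      · subst hE0
        rcases Nat.eq_zero_or_pos m with rfl | hm
        · simp at hD
        · simpa using hm
      · have := Nat.mul_lt_mul_of_pos_right hp.out.one_lt (wt_pos hp.out.pos hE0)
        omega
    · intro i F hF
      have := hh (i + 1) (Multiset.replicate m 0 + F.map (· + 1)) (by simp; omega)
      beta_reduce
      rw [Multiset.map_add, Multiset.map_replicate, Multiset.map_cons, Multiset.add_cons, ← this]
      congr 1
      abel
    · simp at hk; omega
    · simpa using hcard
  · obtain ⟨E, h1, h2, h3, h4⟩ := hh.exists_count_lt hk hcard hwt hlt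
    rw [← h4]
    exact ihs _ (by omega) E D' (h1 ▸ hk) (h1.trans hcard) (h2.trans hwt) (h2.trans hn) rfl

theorem IsDescent.smul_eq_pow_smul {h : Multiset ℕ → A} (hh : IsDescent p k h) (r : ℕ)
    (D D' : Multiset ℕ) (hk : k ≤ Multiset.card D)
    (hcard : Multiset.card D' = Multiset.card D + r * (p - 1)) (hwt : wt p D = wt p D') :
    p • h D' = p ^ (r + 1) • h D := by
  have hp1 := hp.out.one_lt
  induction r generalizing D with
  | zero => simpa using (hh.smul_eq_smul D D' hk (by simpa using hcard.symm) hwt).symm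
  | succ r ih =>
    -- Otherwise the weight of `D` equals its size, which is less than the size of `D'` and hence
    -- than its weight. Splitting `i + 1` into `p` copies of `i` then adds `p - 1` elements and
    -- yields one factor `p`.
    obtain ⟨i, hi⟩ : ∃ i, i + 1 ∈ D := by
      by_contra hno
      push Not at hno
      have : ∀ j ∈ D, j = 0 := fun j hj => by
        by_contra hj0
        obtain ⟨j, rfl⟩ := Nat.exists_eq_succ_of_ne_zero hj0
        exact hno j hj
      have h1 : wt p D = Multiset.card D := by
        rw [Multiset.eq_replicate_card.2 this]
        simp
      have h2 := card_le_wt hp.out.pos D'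
      have h3 : 0 < (r + 1) * (p - 1) := Nat.mul_pos (Nat.succ_pos _) (by omega)
      omega
    obtain ⟨D, rfl⟩ := Multiset.exists_cons_of_mem hi
    rw [ih (Multiset.replicate p i + D), hh i D (by simpa using hk), smul_smul, ← pow_succ]
    · simp at hk ⊢; omega
    · have : (r + 1) * (p - 1) = r * (p - 1) + (p - 1) := by ring
      simp at hcard ⊢; omega
    · rw [← hwt]
      simp [pow_succ']

theorem wt_modEq_card (D : Multiset ℕ) : wt p D ≡ Multiset.card D [MOD (p - 1)] := by
  induction D using Multiset.induction_on with
  | empty => simp; rfl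
  | cons i D ih =>
    rw [wt_cons, Multiset.card_cons, add_comm]
    refine ih.add ?_
    have : p ≡ 1 [MOD (p - 1)] := ((Nat.modEq_iff_dvd' hp.out.pos).2 dvd_rfl).symm
    simpa using this.pow i

/-- Sizes at equal weight agree modulo `p - 1`, so the same power of `p` relates both `h` and `z` at
`D` and `D'`. -/
theorem IsDescent.cross_eq {h : Multiset ℕ → A} {z : Multiset ℕ → ℤ} (hh : IsDescent p k h)
    (hz : IsDescent p k z) (D D' : Multiset ℕ) (hk : k ≤ Multiset.card D)
    (hk' : k ≤ Multiset.card D') (hwt : wt p D = wt p D') :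
    p • z D' • h D = p • z D • h D' := by
  wlog hle : Multiset.card D ≤ Multiset.card D' generalizing D D'
  · exact (this D' D hk' hk hwt.symm (not_le.1 hle).le).symm
  obtain ⟨r, hr⟩ : ∃ r, Multiset.card D' = Multiset.card D + r * (p - 1) := by
    have : Multiset.card D ≡ Multiset.card D' [MOD (p - 1)] :=
      (wt_modEq_card D).symm.trans (hwt ▸ wt_modEq_card D')
    obtain ⟨r, hr⟩ := (Nat.modEq_iff_dvd' hle).1 this
    exact ⟨r, by rw [mul_comm, ← hr]; omega⟩
  have h1 := hh.smul_eq_pow_smul r D D' hk hr hwt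
  have h2 := hz.smul_eq_pow_smul r D D' hk hr hwt
  rw [← smul_assoc, h2, smul_comm p, h1, smul_assoc, smul_comm]

/-- Two cocycles, one of them with integral values, are proportional up to elements killed by `p`
and by integers prime to `p`. -/
theorem IsBinomial.exists_coprime {c : Multiset ℕ → A} {z : Multiset ℕ → ℤ}
    (hc : IsBinomial k c) (hz : IsBinomial k z) (hk : 0 < k) (x y : Multiset ℕ) (hx : 0 ∉ x)
    (hy : 0 ∉ y) (hxk : Multiset.card x = k) (hyk : Multiset.card y = k) (hxy : x.sum = y.sum) :
    ∃ m : ℕ, m.Coprime p ∧ (m * p) • (z y • c x - z x • c y) = 0 := by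
  -- Writing each exponent in base `p` represents the monomial by products of the `y_i`, up to a
  -- factor prime to `p`. These factors make up `m`.
  have lift : ∀ x : Multiset ℕ, 0 ∉ x → ∃ W : Multiset (Multiset ℕ), 0 ∉ W ∧
      W.map (wt p) = x ∧ ((W.map (dpow p)).prod).Coprime p := by
    intro x
    induction x using Multiset.induction_on with
    | empty => exact fun _ => ⟨0, by simp⟩
    | cons i x ih =>
      intro hx
      simp only [Multiset.mem_cons, not_or] at hx
      obtain ⟨W, h1, h2, h3⟩ := ih hx.2
      obtain ⟨D, h4, h5, h6⟩ := exists_dpow_coprime (p := p) (Nat.pos_of_ne_zero (Ne.symm hx.1))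
      refine ⟨D ::ₘ W, by simp [h1, Ne.symm h4], by simp [h2, h5], ?_⟩
      rw [Multiset.map_cons, Multiset.prod_cons]
      exact h6.mul_left h3
  obtain ⟨f, hf, hf'⟩ := hc.exists_descent (p := p) hk
  obtain ⟨g, hg, hg'⟩ := hz.exists_descent (p := p) hk
  obtain ⟨W, hW, rfl, hWp⟩ := lift x hx
  obtain ⟨V, hV, rfl, hVp⟩ := lift y hy
  rw [Multiset.card_map] at hxk hyk
  have hwt : ∀ W : Multiset (Multiset ℕ), wt p W.sum = (W.map (wt p)).sum := by
    intro W
    induction W using Multiset.induction_on with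
    | empty => simp
    | cons w W ih => simp [ih]
  have h := IsDescent.cross_eq hf' hg' W.sum V.sum (hxk ▸ card_le_card_sum hW) (hyk ▸ card_le_card_sum hV)
    (by rw [hwt, hwt, hxy])
  rw [hf W hxk hW, hf V hyk hV, hg W hxk hW, hg V hyk hV] at h
  refine ⟨(W.map (dpow p)).prod * (V.map (dpow p)).prod, hWp.mul_left hVp, ?_⟩
  rw [smul_sub, sub_eq_zero]
  simp only [pullback] at h
  simp only [← natCast_zsmul, smul_smul, smul_eq_mul] at h ⊢
  convert h using 2 <;> push_cast <;> ring

end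

/-! ### Cocycle conditions in terms of coefficients. -/

/-- The coefficient of `x₀ ^ u * x₁ ^ v` in `(x₀ + x₁) ^ (u + v) - x₁ ^ (u + v)`. -/
def binom (u v : ℕ) : ℤ := (u + v).choose u - if u = 0 then 1 else 0

theorem prod_X_pow_cons (R : Type*) [CommRing R] {m : ℕ} (i j l : ℕ) (a : Fin m →₀ ℕ) :
    (X 0 ^ i * (X 1 ^ j * (X 2 ^ l * ∏ t : Fin m, X t.succ.succ.succ ^ a t)) :
      MvPolynomial (Fin (m + 3)) R) =
      monomial (Finsupp.cons i (Finsupp.cons j (Finsupp.cons l a))) 1 := by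
  rw [monomial_eq, Finsupp.prod_fintype _ _ (by simp), Fin.prod_univ_succ, Fin.prod_univ_succ,
    Fin.prod_univ_succ]
  simp only [Finsupp.cons_zero, Finsupp.cons_succ, C_1, one_mul]
  rfl

/-- The two outer terms of `delta` contribute only for `u = 0` or `w = 0`; they are the corrections
in `binom`. Stated for linear maps, the identity can also be tensored with `A`. -/
theorem lcoeff_comp_delta (R : Type*) [CommRing R] (m u v w : ℕ) (a : Fin m →₀ ℕ) :
    lcoeff R (Finsupp.cons u (Finsupp.cons v (Finsupp.cons w a))) ∘ₗ delta R (m + 2) =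
      binom w v • lcoeff R (Finsupp.cons u (Finsupp.cons (v + w) a)) -
        binom u v • lcoeff R (Finsupp.cons (u + v) (Finsupp.cons w a)) := by
  refine MvPolynomial.linearMap_ext fun s => LinearMap.ext_ring ?_
  rw [← Finsupp.cons_tail s, ← Finsupp.cons_tail s.tail]
  generalize s.tail.tail = b
  generalize s.tail 0 = j
  generalize s 0 = i
  have hs : ∀ f : Fin (m + 2) → MvPolynomial (Fin (m + 3)) R,
      aeval f (monomial (Finsupp.cons i (Finsupp.cons j b)) (1 : R)) =
        f 0 ^ i * (f 1 ^ j * ∏ t : Fin m, f t.succ.succ ^ b t) := by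
    intro f
    rw [aeval_monomial, map_one, one_mul, Finsupp.prod_fintype _ _ (by simp), Fin.prod_univ_succ,
      Fin.prod_univ_succ]
    simp only [Finsupp.cons_zero, Finsupp.cons_succ]
    rfl
  have e1 := prod_X_pow_cons R 0 i j b
  have e4 := prod_X_pow_cons R i j 0 b
  simp only [pow_zero, one_mul] at e1 e4
  simp only [LinearMap.comp_apply, delta, LinearMap.add_apply, LinearMap.sub_apply,
    AlgHom.toLinearMap_apply, hs, LinearMap.smul_apply]
  simp only [Fin.val_zero, Fin.val_one, Fin.val_succ, if_true, one_ne_zero, if_false,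
    Nat.succ_ne_zero, Fin.castSucc_zero, Fin.succ_zero_eq_one, Fin.succ_one_eq_two,
    Fin.castSucc_one, zero_lt_two, one_lt_two, e1]
  have c1 : ∀ x : ℕ, (x + 1 + 1 = 1) = False := by simp
  have c2 : ∀ x : ℕ, (x + 1 + 1 < 2) = False := by simp
  simp only [c1, c2, if_false, e4]
  have e2 : (X 0 + X 1) ^ i * (X 2 ^ j * ∏ t : Fin m, X t.succ.succ.succ ^ b t) =
      ∑ x ∈ Finset.HasAntidiagonal.antidiagonal i, i.choose x.1 •
        monomial (Finsupp.cons x.1 (Finsupp.cons x.2 (Finsupp.cons j b))) (1 : R) := by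
    rw [(Commute.all _ _).add_pow', Finset.sum_mul]
    simp only [smul_mul_assoc, mul_assoc, prod_X_pow_cons]
  have e3 : X 0 ^ i * ((X 1 + X 2) ^ j * ∏ t : Fin m, X t.succ.succ.succ ^ b t) =
      ∑ x ∈ Finset.HasAntidiagonal.antidiagonal j, j.choose x.1 •
        monomial (Finsupp.cons i (Finsupp.cons x.1 (Finsupp.cons x.2 b))) (1 : R) := by
    rw [(Commute.all _ _).add_pow', Finset.sum_mul, Finset.mul_sum]
    simp only [smul_mul_assoc, mul_smul_comm, mul_assoc, prod_X_pow_cons]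
  have hsum : ∀ (i u v : ℕ) (P : Prop) [Decidable P],
      ∑ x ∈ Finset.HasAntidiagonal.antidiagonal i, i.choose x.1 • (if x.1 = u ∧ x.2 = v ∧ P then (1 : R) else 0) =
        if i = u + v ∧ P then ((u + v).choose u : R) else 0 := by
    intro i u v P _
    by_cases hP : P
    · have : ∀ x : ℕ × ℕ, (x.1 = u ∧ x.2 = v) = (x = (u, v)) := fun x => by
        rw [Prod.ext_iff]
      simp only [hP, and_true, this, smul_ite, smul_zero, Finset.sum_ite_eq',
        Finset.HasAntidiagonal.mem_antidiagonal, eq_comm (a := u + v)]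
      split_ifs with h
      · simp [h]
      · rfl
    · simp [hP]
  rw [e2, e3]
  simp only [map_sub, map_add, map_sum, map_nsmul, lcoeff_apply, coeff_monomial,
    Finsupp.cons_injective2.eq_iff]
  have h3 := hsum j v w (i = u ∧ b = a)
  have h2 := hsum i u v (j = w ∧ b = a)
  have hc : ∀ x : ℕ × ℕ, (i = u ∧ x.1 = v ∧ x.2 = w ∧ b = a) =
      (x.1 = v ∧ x.2 = w ∧ i = u ∧ b = a) := fun x => by
    rw [eq_iff_iff]
    tauto
  simp only [hc]
  rw [h2, h3]
  have hL : (if 0 = u ∧ i = v ∧ j = w ∧ b = a then (1 : R) else 0) -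
      (if i = u + v ∧ j = w ∧ b = a then ((u + v).choose u : R) else 0) =
      -(binom u v • if i = u + v ∧ j = w ∧ b = a then (1 : R) else 0) := by
    by_cases hu : u = 0
    · subst hu
      simp [binom]
    · simp [binom, hu, Ne.symm hu]
  have hR : (if j = v + w ∧ i = u ∧ b = a then ((v + w).choose v : R) else 0) -
      (if i = u ∧ j = v ∧ 0 = w ∧ b = a then (1 : R) else 0) =
      binom w v • if i = u ∧ j = v + w ∧ b = a then (1 : R) else 0 := by
    by_cases hw : w = 0
    · subst hw
      simp only [binom, add_zero, zero_add, Nat.choose_self, Nat.choose_zero_right, if_true,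
        true_and, Nat.cast_one, sub_self, zero_smul, sub_eq_zero]
      congr 1
      rw [eq_iff_iff]
      tauto
    · simp only [binom, hw, Ne.symm hw, if_false, false_and, and_false, sub_zero, add_comm w v,
        natCast_zsmul, nsmul_eq_mul, mul_ite, mul_one, mul_zero]
      congr 1
      · rw [eq_iff_iff]
        tauto
      · rw [Nat.choose_symm_add]
  rw [add_sub_assoc, hL, hR]
  abel

/-- The conditions on the coefficients of a homogeneous symmetric `2`-cocycle in `m + 2` variables,
with values in an abelian group. -/
structure IsCoc {A : Type*} [AddCommGroup A] (m n : ℕ) (c : (Fin (m + 2) →₀ ℕ) → A) : Prop where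
  symm : ∀ (e : Equiv.Perm (Fin (m + 2))) a, c (a.mapDomain e) = c a
  homog : ∀ a, c a ≠ 0 → a.degree = n
  rel : ∀ u v w a, binom w v • c (Finsupp.cons u (Finsupp.cons (v + w) a)) =
    binom u v • c (Finsupp.cons (u + v) (Finsupp.cons w a))

theorem coeff_delta {R : Type*} [CommRing R] (m u v w : ℕ) (a : Fin m →₀ ℕ)
    (f : MvPolynomial (Fin (m + 2)) R) :
    coeff (Finsupp.cons u (Finsupp.cons v (Finsupp.cons w a))) (delta R (m + 2) f) =
      binom w v • coeff (Finsupp.cons u (Finsupp.cons (v + w) a)) f -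
        binom u v • coeff (Finsupp.cons (u + v) (Finsupp.cons w a)) f :=
  LinearMap.congr_fun (lcoeff_comp_delta R m u v w a) f

theorem mapDomain_perm_symm {k : ℕ} (e : Equiv.Perm (Fin k)) (a : Fin k →₀ ℕ) :
    (a.mapDomain e.symm).mapDomain e = a := by
  rw [← Finsupp.mapDomain_comp, Equiv.self_comp_symm, Finsupp.mapDomain_id]

theorem mem_cocycles_iff {R : Type*} [CommRing R] {m n : ℕ} {f : MvPolynomial (Fin (m + 2)) R} :
    f ∈ cocycles R (m + 2) n ↔ IsCoc m n fun a => coeff a f := by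
  simp only [cocycles, Submodule.mem_inf, Subalgebra.mem_toSubmodule, mem_symmetricSubalgebra,
    mem_homogeneousSubmodule, LinearMap.mem_ker]
  constructor
  · rintro ⟨⟨h1, h2⟩, h3⟩
    refine ⟨fun e a => ?_, fun a ha => ?_, fun u v w a => ?_⟩
    · conv_lhs => rw [← h1 e]
      exact coeff_rename_mapDomain _ e.injective _ _
    · rw [Finsupp.degree_eq_weight_one]
      exact h2 ha
    · rw [← sub_eq_zero, ← coeff_delta, h3, coeff_zero]
  · intro h
    refine ⟨⟨fun e => ?_, fun a ha => ?_⟩, ?_⟩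
    · ext b
      rw [← mapDomain_perm_symm e b, coeff_rename_mapDomain _ e.injective]
      exact (h.symm _ _).symm
    · have := h.homog a ha
      rwa [Finsupp.degree_eq_weight_one] at this
    · ext b
      rw [← Finsupp.cons_tail b, ← Finsupp.cons_tail b.tail, ← Finsupp.cons_tail b.tail.tail,
        coeff_delta, coeff_zero, sub_eq_zero]
      exact h.rel _ _ _ _

/-- The coefficient of a monomial in an element of `A ⊗ ℤ[x₁, …, x_k]`. -/
noncomputable def tcoeff (A : Type*) [AddCommGroup A] {k : ℕ} (a : Fin k →₀ ℕ) :
    A ⊗[ℤ] MvPolynomial (Fin k) ℤ →+ A :=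
  (TensorProduct.rid ℤ A).toAddMonoidHom.comp (LinearMap.lTensor A (lcoeff ℤ a)).toAddMonoidHom

theorem tcoeff_apply {A : Type*} [AddCommGroup A] {k : ℕ} (a : Fin k →₀ ℕ)
    (f : A ⊗[ℤ] MvPolynomial (Fin k) ℤ) :
    tcoeff A a f = TensorProduct.rid ℤ A (LinearMap.lTensor A (lcoeff ℤ a) f) :=
  rfl

section

variable {A : Type*} [AddCommGroup A] {k : ℕ}

@[simp] theorem tcoeff_tmul (a : Fin k →₀ ℕ) (x : A) (f : MvPolynomial (Fin k) ℤ) :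
    tcoeff A a (x ⊗ₜ[ℤ] f) = coeff a f • x := by
  simp [tcoeff_apply]

theorem exists_sum_tcoeff (f : A ⊗[ℤ] MvPolynomial (Fin k) ℤ) :
    ∃ s : Finset (Fin k →₀ ℕ), ∀ t, s ⊆ t →
      f = ∑ a ∈ t, tcoeff A a f ⊗ₜ[ℤ] monomial a (1 : ℤ) := by
  induction f using TensorProduct.induction_on with
  | zero => exact ⟨∅, by simp⟩
  | tmul x g =>
    refine ⟨g.support, fun t ht => ?_⟩
    conv_lhs => rw [g.as_sum, TensorProduct.tmul_sum]
    rw [← Finset.sum_subset ht]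
    · refine Finset.sum_congr rfl fun a _ => ?_
      rw [tcoeff_tmul, TensorProduct.smul_tmul, smul_monomial, smul_eq_mul, mul_one]
    · intro a _ ha
      rw [tcoeff_tmul, notMem_support_iff.1 ha, zero_smul, TensorProduct.zero_tmul]
  | add f g hf hg =>
    classical
    obtain ⟨s, hs⟩ := hf
    obtain ⟨s', hs'⟩ := hg
    refine ⟨s ∪ s', fun t ht => ?_⟩
    have h1 := hs t (Finset.union_subset_left ht)
    have h2 := hs' t (Finset.union_subset_right ht)
    simp only [map_add, TensorProduct.add_tmul, Finset.sum_add_distrib]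
    rw [← h1, ← h2]

theorem IsTensorCocycle.isCoc {m n : ℕ} {f : A ⊗[ℤ] MvPolynomial (Fin (m + 2)) ℤ}
    (hf : IsTensorCocycle A (m + 2) n f) : IsCoc m n fun a => tcoeff A a f := by
  refine ⟨fun e a => ?_, fun a ha => ?_, fun u v w a => ?_⟩
  · conv_lhs => rw [← hf.symmetric e]
    simp only [tcoeff_apply, ← LinearMap.lTensor_comp_apply]
    congr 3
    ext b
    exact coeff_rename_mapDomain _ e.injective _ _
  · by_contra hd
    apply ha
    obtain ⟨g, rfl⟩ := hf.homogeneous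
    simp only [tcoeff_apply, ← LinearMap.lTensor_comp_apply]
    have : lcoeff ℤ a ∘ₗ (homogeneousSubmodule (Fin (m + 2)) ℤ n).subtype = 0 := by
      ext g
      by_contra hg
      refine hd ?_
      rw [Finsupp.degree_eq_weight_one]
      exact g.2 hg
    rw [this, LinearMap.lTensor_zero, LinearMap.zero_apply, map_zero]
  · have h := congrArg (TensorProduct.rid ℤ A) (congrArg (LinearMap.lTensor A
      (lcoeff ℤ (Finsupp.cons u (Finsupp.cons v (Finsupp.cons w a))))) hf.cocycle)
    rw [← LinearMap.lTensor_comp_apply, lcoeff_comp_delta, LinearMap.lTensor_sub,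
      LinearMap.lTensor_smul, LinearMap.lTensor_smul] at h
    simpa [sub_eq_zero, tcoeff_apply] using h

end

/-! ### Passing from exponent vectors to multisets of exponents. -/

theorem exists_perm_of_map_eq {α β : Type*} [Fintype α] {f g : α → β}
    (h : (Finset.univ : Finset α).val.map f = (Finset.univ : Finset α).val.map g) :
    ∃ e : Equiv.Perm α, ∀ i, g (e i) = f i := by
  classical
  have hc : ∀ x, Nonempty ({i // f i = x} ≃ {i // g i = x}) := fun x => by
    refine ⟨Fintype.equivOfCardEq ?_⟩
    have := congrArg (Multiset.count x) h
    rw [Multiset.count_map, Multiset.count_map] at this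
    simp only [eq_comm (a := x)] at this
    rw [Fintype.card_subtype, Fintype.card_subtype]
    exact this
  let E := fun x => (hc x).some
  refine ⟨(Equiv.sigmaFiberEquiv f).symm.trans
    ((Equiv.sigmaCongrRight E).trans (Equiv.sigmaFiberEquiv g)), fun i => ?_⟩
  exact (E (f i) ⟨i, rfl⟩).2

/-- The multiset of the exponents of a monomial. -/
def vals {k : ℕ} (a : Fin k →₀ ℕ) : Multiset ℕ := (Finset.univ : Finset (Fin k)).val.map a

section

variable {k : ℕ}

@[simp] theorem card_vals (a : Fin k →₀ ℕ) : Multiset.card (vals a) = k := by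
  simp [vals]

theorem sum_vals (a : Fin k →₀ ℕ) : (vals a).sum = a.degree := by
  rw [Finsupp.degree_eq_sum]
  rfl

theorem zero_notMem_vals {a : Fin k →₀ ℕ} : 0 ∉ vals a ↔ a.support = Finset.univ := by
  simp [vals, Finset.eq_univ_iff_forall]

@[simp] theorem vals_cons (u : ℕ) (a : Fin k →₀ ℕ) : vals (Finsupp.cons u a) = u ::ₘ vals a := by
  simp only [vals, Fin.univ_val_map, List.ofFn_succ]
  rfl

theorem exists_vals_eq (s : Multiset ℕ) (hs : Multiset.card s = k) :
    ∃ a : Fin k →₀ ℕ, vals a = s := by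
  induction s using Multiset.induction_on generalizing k with
  | empty =>
    rw [Multiset.card_zero] at hs
    subst hs
    exact ⟨0, rfl⟩
  | cons u s ih =>
    rw [Multiset.card_cons] at hs
    subst hs
    obtain ⟨a, ha⟩ := ih rfl
    exact ⟨Finsupp.cons u a, by rw [vals_cons, ha]⟩

theorem exists_mapDomain_eq {a b : Fin k →₀ ℕ} (h : vals a = vals b) :
    ∃ e : Equiv.Perm (Fin k), a.mapDomain e = b := by
  obtain ⟨e, he⟩ := exists_perm_of_map_eq h
  refine ⟨e, ?_⟩
  ext i
  obtain ⟨i, rfl⟩ := e.surjective i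
  rw [Finsupp.mapDomain_apply e.injective, he]

end

section

variable {A : Type*} [AddCommGroup A] {m n : ℕ} {c : (Fin (m + 2) →₀ ℕ) → A}

theorem IsCoc.eq_of_vals_eq (hc : IsCoc m n c) {a b : Fin (m + 2) →₀ ℕ} (h : vals a = vals b) :
    c a = c b := by
  obtain ⟨e, rfl⟩ := exists_mapDomain_eq h
  exact (hc.symm e a).symm

/-- Move a nonzero exponent `x` and a zero to the front. The relation with `v = w = 0` has
coefficients `binom 0 0 = 0` and `binom x 0 = 1`. Constants are excluded because they are cocycles.
-/
theorem IsCoc.eq_zero_of_mem_vals (hc : IsCoc m n c) {a : Fin (m + 2) →₀ ℕ} (h : 0 ∈ vals a)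
    (ha : a ≠ 0) : c a = 0 := by
  obtain ⟨s, hs⟩ := Multiset.exists_cons_of_mem h
  obtain ⟨x, hx, hx0⟩ : ∃ x ∈ s, x ≠ 0 := by
    obtain ⟨i, hi⟩ := Finsupp.ne_iff.1 ha
    have : a i ∈ vals a := Multiset.mem_map_of_mem _ (Finset.mem_univ_val i)
    rw [hs, Multiset.mem_cons] at this
    exact ⟨a i, this.resolve_left hi, hi⟩
  obtain ⟨t, rfl⟩ := Multiset.exists_cons_of_mem hx
  have hk := card_vals a
  rw [hs] at hk
  obtain ⟨b, rfl⟩ := exists_vals_eq (k := m) t (by simpa using hk)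
  rw [hc.eq_of_vals_eq (b := Finsupp.cons x (Finsupp.cons 0 b))
    (by rw [hs, Multiset.cons_swap]; simp)]
  simpa [binom, hx0] using (hc.rel x 0 0 b).symm

theorem IsCoc.exists_isBinomial (hc : IsCoc m n c) :
    ∃ c' : Multiset ℕ → A, IsBinomial (m + 2) c' ∧ ∀ a, c' (vals a) = c a := by
  classical
  let c' : Multiset ℕ → A := fun s =>
    if h : ∃ a : Fin (m + 2) →₀ ℕ, vals a = s then c h.choose else 0
  have hc' : ∀ a, c' (vals a) = c a := fun a => by
    have h : ∃ b : Fin (m + 2) →₀ ℕ, vals b = vals a := ⟨a, rfl⟩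
    simp only [c', dif_pos h]
    exact hc.eq_of_vals_eq h.choose_spec
  refine ⟨c', fun u v w s hu hv hw _ hs => ?_, hc'⟩
  obtain ⟨a, rfl⟩ := exists_vals_eq (k := m) s (by omega)
  have h := hc.rel u v w a
  simp only [binom, hu.ne', hw.ne', if_false, sub_zero, natCast_zsmul, ← hc', vals_cons] at h
  rw [← h, add_comm w v, Nat.choose_symm_add]

theorem IsCoc.exists_coprime (hc : IsCoc m n c) {z : (Fin (m + 2) →₀ ℕ) → ℤ} (hz : IsCoc m n z)
    {p : ℕ} [Fact p.Prime] (a b : Fin (m + 2) →₀ ℕ) :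
    ∃ l : ℕ, l.Coprime p ∧ (l * p) • (z b • c a - z a • c b) = 0 := by
  have trivial_case : ∀ a b : Fin (m + 2) →₀ ℕ, c a = 0 → z a = 0 →
      z b • c a - z a • c b = 0 := fun a b h1 h2 => by rw [h1, h2, smul_zero, zero_smul, sub_zero]
  have finish : z b • c a - z a • c b = 0 →
      ∃ l : ℕ, l.Coprime p ∧ (l * p) • (z b • c a - z a • c b) = 0 := fun h =>
    ⟨1, Nat.coprime_one_left p, by rw [h, smul_zero]⟩
  have hdeg : ∀ a : Fin (m + 2) →₀ ℕ, a.degree ≠ n → c a = 0 ∧ z a = 0 := fun a ha =>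
    ⟨by_contra fun h => ha (hc.homog a h), by_contra fun h => ha (hz.homog a h)⟩
  by_cases han : a.degree = n
  swap
  · exact finish (trivial_case a b (hdeg a han).1 (hdeg a han).2)
  by_cases hbn : b.degree = n
  swap
  · exact finish (by rw [← neg_sub, trivial_case b a (hdeg b hbn).1 (hdeg b hbn).2, neg_zero])
  by_cases hab : a = b
  · exact finish (by rw [hab, sub_self])
  by_cases ha0 : a = 0
  · exact absurd (by rw [ha0, eq_comm, ← Finsupp.degree_eq_zero_iff, hbn, ← han, ha0, map_zero]) hab
  by_cases hb0 : b = 0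
  · exact absurd (by rw [hb0, ← Finsupp.degree_eq_zero_iff, han, ← hbn, hb0, map_zero]) hab
  by_cases ha : 0 ∈ vals a
  · exact finish (trivial_case a b (hc.eq_zero_of_mem_vals ha ha0) (hz.eq_zero_of_mem_vals ha ha0))
  by_cases hb : 0 ∈ vals b
  · exact finish (by rw [← neg_sub, trivial_case b a (hc.eq_zero_of_mem_vals hb hb0)
      (hz.eq_zero_of_mem_vals hb hb0), neg_zero])
  obtain ⟨c', hc', hcc⟩ := hc.exists_isBinomial
  obtain ⟨z', hz', hzz⟩ := hz.exists_isBinomial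
  have := hc'.exists_coprime (p := p) hz' (by omega) (vals a) (vals b) ha hb (card_vals a)
    (card_vals b) (by rw [sum_vals, sum_vals, han, hbn])
  simpa only [hcc, hzz] using this

end

/-! ### The coefficients of `ζ`. -/

theorem coeff_sum_X_pow (k n : ℕ) (I : Finset (Fin k)) (a : Fin k →₀ ℕ) :
    coeff a ((∑ i ∈ I, X i) ^ n : MvPolynomial (Fin k) ℤ) * (∏ i, (a i).factorial : ℕ) =
      if a.degree = n ∧ a.support ⊆ I then (n.factorial : ℤ) else 0 := by
  have hmon : ∀ f ∈ Finset.piAntidiag I n, (∏ i ∈ I, X i ^ f i : MvPolynomial (Fin k) ℤ) =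
      monomial (Finsupp.equivFunOnFinite.symm f) 1 := by
    intro f hf
    rw [monomial_eq, Finsupp.prod_fintype _ _ (by simp), C_1, one_mul]
    refine Finset.prod_subset (Finset.subset_univ _) fun i _ hi => ?_
    have : f i = 0 := by
      by_contra h
      exact hi ((Finset.mem_piAntidiag.1 hf).2 i h)
    simp [this]
  have hmem : (⇑a ∈ Finset.piAntidiag I n) ↔ (a.degree = n ∧ a.support ⊆ I) := by
    rw [Finset.mem_piAntidiag]
    have h1 : (∀ i, a i ≠ 0 → i ∈ I) ↔ a.support ⊆ I := by
      simp [Finset.subset_iff]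
    rw [h1]
    refine and_congr_left fun h => ?_
    rw [Finsupp.degree_apply, ← Finset.sum_subset h (by simp)]
  rw [Finset.sum_pow_eq_sum_piAntidiag, coeff_sum, Finset.sum_congr rfl fun f hf => by
    rw [hmon f hf, ← map_natCast (C : ℤ →+* MvPolynomial (Fin k) ℤ), coeff_C_mul, coeff_monomial]]
  have heq : ∀ f : Fin k → ℕ, (Finsupp.equivFunOnFinite.symm f = a) = (f = ⇑a) := fun f => by
    rw [Equiv.symm_apply_eq]
    rfl
  simp only [heq, mul_ite, mul_one, mul_zero, Finset.sum_ite_eq', hmem]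
  split_ifs with h
  · rw [← Nat.cast_mul]
    congr 1
    have h2 := Nat.multinomial_spec I a
    have h3 : ∑ i ∈ I, a i = n := (Finset.mem_piAntidiag.1 (hmem.2 h)).1
    rw [h3] at h2
    rw [← h2, mul_comm]
    congr 1
    exact (Finset.prod_subset (Finset.subset_univ _) fun i _ hi => by
      rw [Finsupp.notMem_support_iff.1 fun hi' => hi (h.2 hi')]; rfl).symm
  · simp

/-- Expand the product over `i` of `-1 + [i ∉ T]`: any `i` outside `T` gives a factor 0. -/
theorem sum_superset_neg_one_pow {k : ℕ} (T : Finset (Fin k)) :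
    ∑ I : Finset (Fin k), (if T ⊆ I then (-1 : ℤ) ^ I.card else 0) =
      if T = Finset.univ then (-1) ^ k else 0 := by
  have h := Finset.prod_add (fun _ : Fin k => (-1 : ℤ)) (fun i => if i ∈ T then 0 else 1)
    Finset.univ
  rw [Finset.powerset_univ] at h
  have h1 : ∀ I : Finset (Fin k), (∏ i ∈ I, (-1 : ℤ)) *
      ∏ i ∈ Finset.univ \ I, (if i ∈ T then 0 else 1) = if T ⊆ I then (-1 : ℤ) ^ I.card else 0 := by
    intro I
    rw [Finset.prod_const]
    split_ifs with hT
    · rw [Finset.prod_eq_one, mul_one]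
      intro i hi
      rw [if_neg fun hi' => (Finset.mem_sdiff.1 hi).2 (hT hi')]
    · obtain ⟨i, hi, hi'⟩ := Finset.not_subset.1 hT
      rw [Finset.prod_eq_zero (i := i) (by simp [hi']) (by simp [hi]), mul_zero]
  rw [← Finset.sum_congr rfl fun I _ => h1 I, ← h]
  split_ifs with hT
  · simp [hT]
  · obtain ⟨i, hi⟩ : ∃ i, i ∉ T := by
      by_contra hno
      push Not at hno
      exact hT (Finset.eq_univ_iff_forall.2 hno)
    exact Finset.prod_eq_zero (Finset.mem_univ i) (by simp [hi])

theorem coeff_zetaSum {k n : ℕ} (hn : n ≠ 0) (a : Fin k →₀ ℕ) :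
    coeff a (zetaSum k n) * (∏ i, (a i).factorial : ℕ) =
      if a.degree = n ∧ a.support = Finset.univ then (-1) ^ k * (n.factorial : ℤ) else 0 := by
  have h0 : zetaSum k n = ∑ I : Finset (Fin k), C ((-1 : ℤ) ^ I.card) * (∑ i ∈ I, X i) ^ n := by
    rw [zetaSum, ← Finset.sum_erase_add _ _ (Finset.mem_univ ∅)]
    simp [hn]
  rw [h0, coeff_sum, Finset.sum_mul]
  simp only [coeff_C_mul, mul_assoc, coeff_sum_X_pow]
  by_cases hd : a.degree = n
  · have := congrArg (· * (n.factorial : ℤ)) (sum_superset_neg_one_pow a.support)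
    simpa [hd, Finset.sum_mul, ite_mul] using this
  · simp [hd]

theorem zetaSum_zero (k : ℕ) (hk : 0 < k) : zetaSum k 0 = C (-1) := by
  have h := sum_superset_neg_one_pow (∅ : Finset (Fin k))
  rw [if_neg (by
    intro h
    have := Finset.card_univ (α := Fin k)
    simp [← h] at this
    omega), ← Finset.sum_erase_add _ _ (Finset.mem_univ ∅)] at h
  simp only [Finset.empty_subset, if_true, Finset.card_empty, pow_zero] at h
  have h' := congrArg (C : ℤ → MvPolynomial (Fin k) ℤ) (eq_neg_of_add_eq_zero_left h)
  simpa [zetaSum] using h'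

theorem coeff_zetaSum_vals {k n : ℕ} (hn : n ≠ 0) (a : Fin k →₀ ℕ) :
    coeff a (zetaSum k n) * (((vals a).map Nat.factorial).prod : ℕ) =
      if (vals a).sum = n ∧ 0 ∉ vals a then (-1) ^ k * (n.factorial : ℤ) else 0 := by
  have h := coeff_zetaSum hn a
  simp only [← zero_notMem_vals, ← sum_vals] at h
  rw [← h, vals, Multiset.map_map]
  rfl

theorem factorial_prod_ne_zero (s : Multiset ℕ) : (((s.map Nat.factorial).prod : ℕ) : ℤ) ≠ 0 := by
  rw [Nat.cast_ne_zero, Ne, Multiset.prod_eq_zero_iff]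
  simp [Nat.factorial_ne_zero]

theorem isCoc_zetaSum (m n : ℕ) : IsCoc m n fun a => coeff a (zetaSum (m + 2) n) := by
  rcases eq_or_ne n 0 with rfl | hn
  · rw [zetaSum_zero _ (by omega)]
    refine mem_cocycles_iff.1 ⟨⟨fun e => ?_, isHomogeneous_C _ _⟩, ?_⟩
    · exact rename_C _ _
    · simp [delta]
  have hzero : ∀ a : Fin (m + 2) →₀ ℕ, ¬ ((vals a).sum = n ∧ 0 ∉ vals a) →
      coeff a (zetaSum (m + 2) n) = 0 := fun a ha => by
    have := coeff_zetaSum_vals hn a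
    rw [if_neg ha] at this
    exact (mul_eq_zero.1 this).resolve_right (factorial_prod_ne_zero _)
  refine ⟨fun e a => ?_, fun a ha => ?_, fun u v w a => ?_⟩
  · have hv : vals (a.mapDomain e) = vals a := by
      rw [vals, ← Multiset.map_univ_val_equiv e, Multiset.map_map]
      exact Multiset.map_congr rfl fun i _ => Finsupp.mapDomain_apply e.injective _ _
    apply mul_right_cancel₀ (factorial_prod_ne_zero (vals a))
    rw [coeff_zetaSum_vals hn a, ← hv, coeff_zetaSum_vals hn]
  · by_contra hd
    exact ha (hzero a fun h => hd (by rw [← sum_vals, h.1]))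
  · rcases Nat.eq_zero_or_pos u with rfl | hu
    · rw [hzero (Finsupp.cons 0 _) (by simp)]
      simp [binom]
    rcases Nat.eq_zero_or_pos w with rfl | hw
    · rw [hzero (Finsupp.cons _ (Finsupp.cons 0 _)) (by simp)]
      simp [binom]
    have h1 := coeff_zetaSum_vals hn (Finsupp.cons u (Finsupp.cons (v + w) a))
    have h2 := coeff_zetaSum_vals hn (Finsupp.cons (u + v) (Finsupp.cons w a))
    have h3 : (vals (Finsupp.cons u (Finsupp.cons (v + w) a))).sum = n ∧
        0 ∉ vals (Finsupp.cons u (Finsupp.cons (v + w) a)) ↔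
        (vals (Finsupp.cons (u + v) (Finsupp.cons w a))).sum = n ∧
        0 ∉ vals (Finsupp.cons (u + v) (Finsupp.cons w a)) := by
      simp only [vals_cons, Multiset.sum_cons, Multiset.mem_cons, not_or]
      refine and_congr (by omega) ?_
      constructor <;> rintro ⟨-, -, h⟩ <;> exact ⟨by omega, by omega, h⟩
    simp only [h3] at h1
    rw [← h2] at h1
    simp only [vals_cons, Multiset.map_cons, Multiset.prod_cons] at h1
    rw [← Nat.add_choose_mul_factorial_mul_factorial, ← Nat.add_choose_mul_factorial_mul_factorial]
      at h1
    -- Coefficients are known only after multiplication by factorials, so the relation is checked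
    -- after multiplying by a common multiple of both denominators.
    have h4 := factorial_prod_ne_zero (u ::ₘ v ::ₘ w ::ₘ vals a)
    simp only [Multiset.map_cons, Multiset.prod_cons] at h4
    apply mul_right_cancel₀ h4
    have h5 : (u + v).choose u = (u + v).choose v := Nat.choose_symm_add
    simp only [binom, hu.ne', hw.ne', if_false, sub_zero, smul_eq_mul, add_comm w v, h5]
    generalize ((vals a).map Nat.factorial).prod = P at h1 ⊢
    push_cast at h1 ⊢
    linear_combination h1

theorem coeff_zeta {k n : ℕ} (a : Fin k →₀ ℕ) :
    coeff a (zetaSum k n) =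
      (zetaSum k n).support.gcd (fun a => coeff a (zetaSum k n)) * coeff a (zeta k n) := by
  have h : coeff a (zeta k n) =
      coeff a (zetaSum k n) / (zetaSum k n).support.gcd fun a => coeff a (zetaSum k n) := by
    rw [zeta, coeff_sum]
    simp only [coeff_monomial, Finset.sum_ite_eq']
    split_ifs with ha
    · rfl
    · rw [notMem_support_iff.1 ha, Int.zero_ediv]
  rw [h]
  by_cases ha : a ∈ (zetaSum k n).support
  · rw [Int.mul_ediv_cancel' (Finset.gcd_dvd ha)]
  · rw [notMem_support_iff.1 ha, Int.zero_ediv, mul_zero]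

theorem exists_bezout_zeta {k n : ℕ} (h : zetaSum k n ≠ 0) :
    ∃ r : (Fin k →₀ ℕ) → ℤ, ∑ a ∈ (zetaSum k n).support, r a * coeff a (zeta k n) = 1 := by
  obtain ⟨r, hr⟩ := Finset.gcd_eq_sum_mul (zetaSum k n).support fun a => coeff a (zetaSum k n)
  have h0 : ((zetaSum k n).support.gcd fun a => coeff a (zetaSum k n)) ≠ 0 := by
    intro h0
    rw [Finset.gcd_eq_zero_iff] at h0
    exact h (support_eq_empty.1 (Finset.eq_empty_of_forall_notMem fun a ha =>
      mem_support_iff.1 ha (h0 a ha)))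
  refine ⟨r, mul_left_cancel₀ h0 ?_⟩
  rw [mul_one, Finset.mul_sum]
  conv_rhs => rw [hr]
  refine Finset.sum_congr rfl fun a _ => ?_
  rw [coeff_zeta a]
  ring

theorem coeff_zeta_ne_zero {k n : ℕ} {a : Fin k →₀ ℕ} (h : coeff a (zetaSum k n) ≠ 0) :
    coeff a (zeta k n) ≠ 0 := fun h' => h (by rw [coeff_zeta, h', mul_zero])

theorem isCoc_zeta (m n : ℕ) : IsCoc m n fun a => coeff a (zeta (m + 2) n) := by
  by_cases h : zetaSum (m + 2) n = 0
  · have hz : zeta (m + 2) n = 0 := by simp [zeta, h]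
    rw [hz]
    exact mem_cocycles_iff.1 (Submodule.zero_mem _)
  have h0 : ((zetaSum (m + 2) n).support.gcd fun a => coeff a (zetaSum (m + 2) n)) ≠ 0 := by
    intro h0
    refine h (MvPolynomial.ext _ _ fun a => ?_)
    rw [coeff_zeta, h0, zero_mul, coeff_zero]
  have hs := isCoc_zetaSum m n
  refine ⟨fun e a => mul_left_cancel₀ h0 ?_, fun a ha => hs.homog a ?_, fun u v w a =>
    mul_left_cancel₀ h0 ?_⟩
  · rw [← coeff_zeta, ← coeff_zeta]
    exact hs.symm e a
  · rw [coeff_zeta]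
    exact mul_ne_zero h0 ha
  · have := hs.rel u v w a
    rw [coeff_zeta, coeff_zeta (Finsupp.cons (u + v) _)] at this
    simp only [smul_eq_mul] at this ⊢
    linear_combination this

/-- In positive degree `c` lives on monomials involving all variables, where the coefficient is a
signed multinomial coefficient. -/
theorem IsCoc.coeff_zetaSum_ne_zero {A : Type*} [AddCommGroup A] {m n : ℕ}
    {c : (Fin (m + 2) →₀ ℕ) → A} (hc : IsCoc m n c) {a : Fin (m + 2) →₀ ℕ} (ha : c a ≠ 0) :
    coeff a (zetaSum (m + 2) n) ≠ 0 := by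
  have hd := hc.homog a ha
  rcases eq_or_ne n 0 with rfl | hn
  · rw [zetaSum_zero _ (by omega), (Finsupp.degree_eq_zero_iff a).1 hd]
    simp
  · intro h
    have h1 := coeff_zetaSum_vals hn a
    rw [h, zero_mul, sum_vals, if_pos] at h1
    · exact mul_ne_zero (by simp) (Nat.cast_ne_zero.2 (Nat.factorial_ne_zero n)) h1.symm
    · refine ⟨hd, fun h0 => ha (hc.eq_zero_of_mem_vals h0 ?_)⟩
      rintro rfl
      exact hn (by rw [← hd, map_zero])

/-! ### Indecomposable cocycles over a field and linked monomials. -/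

/-- The multiset of the nonzero exponents of a monomial. -/
def shape {k : ℕ} (a : Fin k →₀ ℕ) : Multiset ℕ := a.support.val.map a

theorem shape_eq_filter {k : ℕ} (a : Fin k →₀ ℕ) : shape a = (vals a).filter (· ≠ 0) := by
  have h : a.support = Finset.univ.filter fun i => a i ≠ 0 := by
    ext i
    simp
  rw [vals, Multiset.filter_map, shape, h]
  rfl

theorem vals_eq_of_shape_eq {k : ℕ} {a b : Fin k →₀ ℕ} (h : shape a = shape b) :
    vals a = vals b := by
  have key : ∀ a : Fin k →₀ ℕ,
      vals a = shape a + Multiset.replicate (k - Multiset.card (shape a)) 0 := by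
    intro a
    have h1 := Multiset.filter_add_not (· ≠ 0) (vals a)
    rw [← shape_eq_filter] at h1
    have h2 := congrArg Multiset.card h1
    rw [Multiset.card_add, card_vals] at h2
    conv_lhs => rw [← h1]
    congr 1
    refine Multiset.eq_replicate.2 ⟨by omega, fun x hx => ?_⟩
    simpa using (Multiset.mem_filter.1 hx).2
  rw [key, key, h]

theorem coeff_msymm (R : Type*) [CommRing R] {k n : ℕ} (μ : n.Partition) (a : Fin k →₀ ℕ) :
    coeff a (msymm (Fin k) R μ) = if shape a = μ.parts then 1 else 0 := by
  have hmon : ∀ s : Multiset (Fin k), (s.map (X : Fin k → MvPolynomial (Fin k) R)).prod =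
      monomial (Multiset.toFinsupp s) 1 := by
    intro s
    induction s using Multiset.induction_on with
    | empty => simp
    | cons i s ih =>
      rw [Multiset.map_cons, Multiset.prod_cons, ih, ← Multiset.singleton_add, map_add,
        Multiset.toFinsupp_singleton, X, monomial_mul, one_mul]
  have hshape : ∀ s : Sym (Fin k) n,
      shape (Multiset.toFinsupp s.1) = (Nat.Partition.ofSym s).parts := by
    intro s
    rw [shape, Multiset.toFinsupp_support]
    exact Multiset.map_congr rfl fun i _ => Multiset.toFinsupp_apply _ _
  rw [msymm, coeff_sum]
  simp only [hmon, coeff_monomial]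
  split_ifs with h
  · have hc : Multiset.card (Finsupp.toMultiset a) = n := by
      rw [Finsupp.card_toMultiset, ← μ.parts_sum, ← h]
      rfl
    have hμ := hshape ⟨Finsupp.toMultiset a, hc⟩
    rw [Finsupp.toMultiset_toFinsupp, h] at hμ
    rw [Finset.sum_eq_single ⟨⟨Finsupp.toMultiset a, hc⟩, (Nat.Partition.ext hμ).symm⟩]
    · simp
    · rintro ⟨s, hs⟩ - hne
      rw [if_neg]
      intro hsa
      apply hne
      ext1
      ext1
      exact (congrArg Finsupp.toMultiset hsa).symm.trans (Multiset.toFinsupp_toMultiset _) |>.symm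
    · intro h
      exact absurd (Finset.mem_univ _) h
  · refine Finset.sum_eq_zero fun s _ => if_neg ?_
    rintro rfl
    exact h (by rw [hshape, s.2])

theorem isHomogeneous_msymm (R : Type*) [CommRing R] {k n : ℕ} (μ : n.Partition) :
    (msymm (Fin k) R μ).IsHomogeneous n := by
  intro a ha
  rw [coeff_msymm] at ha
  have h := DFunLike.congr_fun (Finsupp.degree_eq_weight_one (σ := Fin k) (R := ℕ)) a
  refine h.symm.trans ?_
  rw [← μ.parts_sum, ← of_not_not fun h => ha (if_neg h)]
  rfl

section

variable {R : Type*} [CommRing R] {k n : ℕ}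

theorem mem_cocycles_of_mem_span {S : Set n.Partition} {f : MvPolynomial (Fin k) R}
    (hf : f ∈ Submodule.span R (msymm (Fin k) R '' S)) (hd : delta R k f = 0) :
    f ∈ cocycles R k n := by
  refine ⟨?_, hd⟩
  refine Submodule.span_le.2 ?_ hf
  rintro _ ⟨μ, -, rfl⟩
  exact ⟨msymm_isSymmetric _ _ μ, isHomogeneous_msymm R μ⟩

theorem exists_parts_eq_of_mem_span {S : Set n.Partition} {f : MvPolynomial (Fin k) R}
    (hf : f ∈ Submodule.span R (msymm (Fin k) R '' S)) {a : Fin k →₀ ℕ} (ha : coeff a f ≠ 0) :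
    ∃ μ ∈ S, μ.parts = shape a := by
  by_contra! hno
  have h : Submodule.span R (msymm (Fin k) R '' S) ≤ LinearMap.ker (lcoeff R a) := by
    refine Submodule.span_le.2 ?_
    rintro _ ⟨μ, hμ, rfl⟩
    change coeff a _ = 0
    rw [coeff_msymm, if_neg (hno μ hμ).symm]
  exact ha (h hf)

end

section

variable {R : Type*} [CommRing R] {m n : ℕ}

theorem mem_span_msymm {f : MvPolynomial (Fin (m + 2)) R} (hf : f ∈ cocycles R (m + 2) n)
    (S : Set n.Partition) (hS : ∀ a, coeff a f ≠ 0 → ∃ μ ∈ S, μ.parts = shape a) :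
    f ∈ Submodule.span R (msymm (Fin (m + 2)) R '' S) := by
  classical
  have hc := mem_cocycles_iff.1 hf
  let d : n.Partition → R := fun μ =>
    if h : ∃ a : Fin (m + 2) →₀ ℕ, shape a = μ.parts then coeff h.choose f else 0
  have hd : ∀ μ : n.Partition, ∀ a, shape a = μ.parts → d μ = coeff a f := by
    intro μ a ha
    have h : ∃ a : Fin (m + 2) →₀ ℕ, shape a = μ.parts := ⟨a, ha⟩
    simp only [d, dif_pos h]
    exact hc.eq_of_vals_eq (vals_eq_of_shape_eq (h.choose_spec.trans ha.symm))
  have hsum : f = ∑ μ : n.Partition, d μ • msymm (Fin (m + 2)) R μ := by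
    ext a
    rw [coeff_sum]
    simp only [coeff_smul, coeff_msymm, smul_eq_mul, mul_ite, mul_one, mul_zero]
    by_cases ha : coeff a f = 0
    · rw [ha, Finset.sum_eq_zero]
      intro μ _
      split_ifs with h
      · rw [hd μ a h, ha]
      · rfl
    · obtain ⟨μ, -, hμ⟩ := hS a ha
      rw [Finset.sum_eq_single μ, if_pos hμ.symm, hd μ a hμ.symm]
      · intro ν _ hν
        exact if_neg fun h => hν (Nat.Partition.ext (h.symm.trans hμ.symm))
      · exact fun h => absurd (Finset.mem_univ _) h
  rw [hsum]
  refine Submodule.sum_mem _ fun μ _ => ?_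
  by_cases hμ : d μ = 0
  · rw [hμ, zero_smul]
    exact Submodule.zero_mem _
  · refine Submodule.smul_mem _ _ (Submodule.subset_span ⟨μ, ?_, rfl⟩)
    by_cases h : ∃ a : Fin (m + 2) →₀ ℕ, shape a = μ.parts
    · obtain ⟨a, ha⟩ := h
      rw [hd μ a ha] at hμ
      obtain ⟨ν, hν, hνa⟩ := hS a hμ
      rwa [← Nat.Partition.ext (hνa.trans ha)]
    · exact absurd (dif_neg h) hμ

open Classical in
/-- The part of a polynomial that consists of the monomials with a given property. -/
noncomputable def restr (C : (Fin (m + 2) →₀ ℕ) → Prop) (f : MvPolynomial (Fin (m + 2)) R) :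
    MvPolynomial (Fin (m + 2)) R :=
  ∑ a ∈ f.support with C a, monomial a (coeff a f)

open Classical in
theorem coeff_restr (C : (Fin (m + 2) →₀ ℕ) → Prop) (f : MvPolynomial (Fin (m + 2)) R)
    (a : Fin (m + 2) →₀ ℕ) : coeff a (restr C f) = if C a then coeff a f else 0 := by
  rw [restr, coeff_sum]
  simp only [coeff_monomial, Finset.sum_ite_eq', Finset.mem_filter, mem_support_iff]
  by_cases h : coeff a f = 0
  · simp [h]
  · simp [h]

theorem coeff_restr_of {C : (Fin (m + 2) →₀ ℕ) → Prop} (f : MvPolynomial (Fin (m + 2)) R)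
    {a : Fin (m + 2) →₀ ℕ} (h : C a) : coeff a (restr C f) = coeff a f := by
  rw [coeff_restr, if_pos h]

theorem coeff_restr_of_not {C : (Fin (m + 2) →₀ ℕ) → Prop} (f : MvPolynomial (Fin (m + 2)) R)
    {a : Fin (m + 2) →₀ ℕ} (h : ¬ C a) : coeff a (restr C f) = 0 := by
  rw [coeff_restr, if_neg h]

theorem of_coeff_restr_ne_zero {C : (Fin (m + 2) →₀ ℕ) → Prop}
    {f : MvPolynomial (Fin (m + 2)) R} {a : Fin (m + 2) →₀ ℕ} (h : coeff a (restr C f) ≠ 0) :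
    C a ∧ coeff a f ≠ 0 := by
  have hC : C a := by_contra fun hC => h (coeff_restr_of_not f hC)
  exact ⟨hC, fun h' => h ((coeff_restr_of f hC).trans h')⟩

theorem restr_add_restr_not (C : (Fin (m + 2) →₀ ℕ) → Prop) (f : MvPolynomial (Fin (m + 2)) R) :
    restr C f + restr (fun a => ¬ C a) f = f := by
  ext a
  rw [coeff_add, coeff_restr, coeff_restr]
  by_cases h : C a <;> simp [h]

variable (R m n) in
/-- Two monomials are linked if every cocycle that contains one of them contains the other one. -/
def Linked (a b : Fin (m + 2) →₀ ℕ) : Prop :=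
  ∀ f ∈ cocycles R (m + 2) n, coeff a f ≠ 0 ↔ coeff b f ≠ 0

theorem Linked.refl (a : Fin (m + 2) →₀ ℕ) : Linked R m n a a := fun _ _ => Iff.rfl

theorem Linked.iff_right {a x y : Fin (m + 2) →₀ ℕ} (h : Linked R m n x y) :
    Linked R m n a x ↔ Linked R m n a y :=
  forall₂_congr fun f hf => by rw [h f hf]

theorem linked_of_shape_eq {a b : Fin (m + 2) →₀ ℕ} (h : shape a = shape b) :
    Linked R m n a b := fun f hf => by
  rw [(mem_cocycles_iff.1 hf).eq_of_vals_eq (vals_eq_of_shape_eq h)]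

end

section

variable {F : Type*} [Field F] {m n : ℕ}

/-- Each condition reads `x • c a = y • c b`. If `x` and `y` are both nonzero in `F`, the monomials
are linked and are kept or dropped together; otherwise both sides already vanish. -/
theorem restr_mem_cocycles {C : (Fin (m + 2) →₀ ℕ) → Prop}
    (hC : ∀ a b, Linked F m n a b → (C a ↔ C b)) {f : MvPolynomial (Fin (m + 2)) F}
    (hf : f ∈ cocycles F (m + 2) n) : restr C f ∈ cocycles F (m + 2) n := by
  classical
  have key : ∀ (x y : ℤ) (a b : Fin (m + 2) →₀ ℕ),
      (∀ g ∈ cocycles F (m + 2) n, x • coeff a g = y • coeff b g) →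
      x • coeff a (restr C f) = y • coeff b (restr C f) := by
    intro x y a b h
    have hfab := h f hf
    simp only [zsmul_eq_mul] at h hfab ⊢
    rw [coeff_restr, coeff_restr]
    by_cases hx : (x : F) = 0
    · rw [hx, zero_mul] at hfab ⊢
      rw [mul_ite, ← hfab, mul_zero, ite_self]
    by_cases hy : (y : F) = 0
    · rw [hy, zero_mul] at hfab ⊢
      rw [mul_ite, hfab, mul_zero, ite_self]
    have hab : Linked F m n a b := by
      intro g hg
      rw [← mul_ne_zero_iff_left hx, h g hg, mul_ne_zero_iff_left hy]
    simp only [hC a b hab]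
    split_ifs
    · exact hfab
    · rw [mul_zero, mul_zero]
  have hfc := mem_cocycles_iff.1 hf
  refine mem_cocycles_iff.2 ⟨fun e a => ?_, fun a ha => hfc.homog a (of_coeff_restr_ne_zero ha).2,
    fun u v w a => ?_⟩
  · simpa using key 1 1 (a.mapDomain e) a fun g hg => by
      simpa using (mem_cocycles_iff.1 hg).symm e a
  · exact key _ _ _ _ fun g hg => (mem_cocycles_iff.1 hg).rel u v w a

theorem restr_linked_mem_cocycles {f : MvPolynomial (Fin (m + 2)) F}
    (hf : f ∈ cocycles F (m + 2) n) (a : Fin (m + 2) →₀ ℕ) :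
    restr (Linked F m n a) f ∈ cocycles F (m + 2) n ∧
      restr (fun b => ¬ Linked F m n a b) f ∈ cocycles F (m + 2) n :=
  ⟨restr_mem_cocycles (fun _ _ h => h.iff_right) hf,
    restr_mem_cocycles (fun _ _ h => not_congr h.iff_right) hf⟩

theorem linked_of_isIndecomposable {f : MvPolynomial (Fin (m + 2)) F}
    (hf : IsIndecomposable F (m + 2) n f) {a b : Fin (m + 2) →₀ ℕ} (ha : coeff a f ≠ 0)
    (hb : coeff b f ≠ 0) : Linked F m n a b := by
  by_contra hab
  obtain ⟨h1, h2⟩ := restr_linked_mem_cocycles hf.1 a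
  have hfc := mem_cocycles_iff.1 hf.1
  have hpart : ∀ x, coeff x f ≠ 0 → ∃ μ : n.Partition, μ.parts = shape x := fun x hx =>
    ⟨⟨shape x, fun {i} hi => by
        obtain ⟨j, hj, rfl⟩ := Multiset.mem_map.1 hi
        exact Nat.pos_of_ne_zero (Finsupp.mem_support_iff.1 hj), hfc.homog x hx⟩, rfl⟩
  refine hf.2.2 ⟨{μ | ∃ x, Linked F m n a x ∧ shape x = μ.parts}, _, ?_, _, ?_, ?_, ?_,
    LinearMap.mem_ker.1 h1.2, LinearMap.mem_ker.1 h2.2, restr_add_restr_not _ f⟩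
  · refine mem_span_msymm h1 _ fun x hx => ?_
    obtain ⟨hx1, hx2⟩ := of_coeff_restr_ne_zero hx
    obtain ⟨μ, hμ⟩ := hpart x hx2
    exact ⟨μ, ⟨x, hx1, hμ.symm⟩, hμ⟩
  · refine mem_span_msymm h2 _ fun x hx => ?_
    obtain ⟨hx1, hx2⟩ := of_coeff_restr_ne_zero hx
    obtain ⟨μ, hμ⟩ := hpart x hx2
    refine ⟨μ, ?_, hμ⟩
    rintro ⟨y, hy, hyμ⟩
    exact hx1 ((linked_of_shape_eq (hyμ.trans hμ)).iff_right.1 hy)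
  · exact fun h => ha (by rw [← coeff_restr_of (C := Linked F m n a) f (Linked.refl a), h, coeff_zero])
  · exact fun h => hb (by
      rw [← coeff_restr_of (C := fun b => ¬ Linked F m n a b) f hab, h, coeff_zero])

/-- The summands of a decomposition would have disjoint supports inside one class, whereas a cocycle
containing one monomial of a class contains all of them. -/
theorem isIndecomposable_restr {f : MvPolynomial (Fin (m + 2)) F} (hf : f ∈ cocycles F (m + 2) n)
    {a : Fin (m + 2) →₀ ℕ} (ha : coeff a f ≠ 0) :
    IsIndecomposable F (m + 2) n (restr (Linked F m n a) f) := by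
  refine ⟨(restr_linked_mem_cocycles hf a).1,
    fun h => ha (by rw [← coeff_restr_of (C := Linked F m n a) f (Linked.refl a), h, coeff_zero]), ?_⟩
  rintro ⟨S, f₁, h1, f₂, h2, hn1, hn2, hd1, hd2, hsum⟩
  obtain ⟨x, hx⟩ := exists_coeff_ne_zero hn1
  obtain ⟨y, hy⟩ := exists_coeff_ne_zero hn2
  have hdisj : ∀ x, coeff x f₁ ≠ 0 → coeff x f₂ ≠ 0 → False := by
    intro x h h'
    obtain ⟨μ, hμ, hμx⟩ := exists_parts_eq_of_mem_span h1 h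
    obtain ⟨ν, hν, hνx⟩ := exists_parts_eq_of_mem_span h2 h'
    exact hν (Nat.Partition.ext (hνx.trans hμx.symm) ▸ hμ)
  have hx2 : coeff x f₂ = 0 := not_not.1 (hdisj x hx)
  have hy1 : coeff y f₁ = 0 := not_not.1 fun h => hdisj y h hy
  have hxC : Linked F m n a x := (of_coeff_restr_ne_zero (f := f) (by
    rwa [← hsum, coeff_add, hx2, add_zero])).1
  have hyC : Linked F m n a y := (of_coeff_restr_ne_zero (f := f) (by
    rwa [← hsum, coeff_add, hy1, zero_add])).1
  have hf1 := mem_cocycles_of_mem_span h1 hd1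
  exact ((hyC f₁ hf1).1 ((hxC f₁ hf1).2 hx)) hy1

theorem exists_unit_smul_eq {f g : MvPolynomial (Fin (m + 2)) F}
    (hf : IsIndecomposable F (m + 2) n f) (hg : IsIndecomposable F (m + 2) n g)
    {a : Fin (m + 2) →₀ ℕ} (ha : coeff a f ≠ 0) (ha' : coeff a g ≠ 0) :
    ∃ u : Fˣ, f = (u : F) • g := by
  refine ⟨Units.mk0 (coeff a f / coeff a g) (div_ne_zero ha ha'), ?_⟩
  rw [Units.val_mk0, ← sub_eq_zero]
  -- This cocycle vanishes at `a`, hence on the class of `a`, which contains both supports.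
  have hmem : f - (coeff a f / coeff a g) • g ∈ cocycles F (m + 2) n :=
    Submodule.sub_mem _ hf.1 (Submodule.smul_mem _ _ hg.1)
  have h0 : coeff a (f - (coeff a f / coeff a g) • g) = 0 := by
    rw [coeff_sub, coeff_smul, smul_eq_mul, div_mul_cancel₀ _ ha', sub_self]
  by_contra hne
  obtain ⟨b, hb⟩ := exists_coeff_ne_zero hne
  by_cases hab : Linked F m n a b
  · exact (hab _ hmem).2 hb h0
  · apply hb
    rw [coeff_sub, coeff_smul, not_not.1 fun h => hab (linked_of_isIndecomposable hf ha h),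
      not_not.1 fun h => hab (linked_of_isIndecomposable hg ha' h), smul_zero, sub_zero]

/-- The indecomposable cocycles over a field form a basis of the space of cocycles. -/
theorem ListsIndecomposables.basis {ι : Type*} {β : ι → MvPolynomial (Fin (m + 2)) F}
    (hβ : ListsIndecomposables F (m + 2) n β) :
    LinearIndependent F β ∧ Submodule.span F (Set.range β) = cocycles F (m + 2) n := by
  constructor
  · rw [linearIndependent_iff']
    intro s g hg i hi
    obtain ⟨a, ha⟩ := exists_coeff_ne_zero (hβ.1 i).2.1
    have hj : ∀ j ∈ s, j ≠ i → coeff a (g j • β j) = 0 := by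
      intro j _ hji
      by_contra h
      rw [coeff_smul] at h
      obtain ⟨u, hu⟩ := exists_unit_smul_eq (hβ.1 i) (hβ.1 j) ha (right_ne_zero_of_smul h)
      exact hji ((hβ.2 (β i) (hβ.1 i)).unique ⟨u, hu⟩ ⟨1, by simp⟩)
    have := congrArg (coeff a) hg
    rw [coeff_sum, Finset.sum_eq_single i hj fun h => absurd hi h, coeff_smul, coeff_zero,
      smul_eq_mul] at this
    exact (mul_eq_zero.1 this).resolve_right ha
  · apply le_antisymm
    · refine Submodule.span_le.2 ?_
      rintro _ ⟨i, rfl⟩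
      exact (hβ.1 i).1
    · intro f hf
      -- Split off one link class at a time; each is a multiple of a listed indecomposable.
      induction hN : f.support.card using Nat.strong_induction_on generalizing f with
      | _ N ih =>
      rcases eq_or_ne f 0 with rfl | hf0
      · exact Submodule.zero_mem _
      obtain ⟨a, ha⟩ := exists_coeff_ne_zero hf0
      obtain ⟨h1, h2⟩ := restr_linked_mem_cocycles hf a
      rw [← restr_add_restr_not (Linked F m n a) f]
      refine Submodule.add_mem _ ?_ (ih _ ?_ h2 rfl)
      · obtain ⟨i, ⟨u, hu⟩, -⟩ := hβ.2 _ (isIndecomposable_restr hf ha)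
        rw [hu]
        exact Submodule.smul_mem _ _ (Submodule.subset_span ⟨i, rfl⟩)
      · rw [← hN]
        refine Finset.card_lt_card (Finset.ssubset_iff_of_subset ?_ |>.2 ⟨a, ?_, ?_⟩)
        · exact fun x hx =>
            mem_support_iff.2 (of_coeff_restr_ne_zero (mem_support_iff.1 hx)).2
        · exact mem_support_iff.2 ha
        · exact fun h => (of_coeff_restr_ne_zero (mem_support_iff.1 h)).1 (Linked.refl a)

end

/-! ### Coefficients in an arbitrary abelian group. -/

section

variable {A B : Type*} [AddCommGroup A] [AddCommGroup B] {m n : ℕ}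

theorem IsCoc.map {c : (Fin (m + 2) →₀ ℕ) → A} (hc : IsCoc m n c) (φ : A →+ B) :
    IsCoc m n fun a => φ (c a) where
  symm e a := by rw [hc.symm]
  homog a ha := hc.homog a fun h => ha (by rw [h, map_zero])
  rel u v w a := by rw [← map_zsmul, hc.rel, map_zsmul]

theorem IsCoc.sub {c d : (Fin (m + 2) →₀ ℕ) → A} (hc : IsCoc m n c) (hd : IsCoc m n d) :
    IsCoc m n fun a => c a - d a where
  symm e a := by rw [hc.symm, hd.symm]
  homog a ha := by
    by_contra h
    rw [not_not.1 fun h' => h (hc.homog a h'), not_not.1 fun h' => h (hd.homog a h'),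
      sub_zero] at ha
    exact ha rfl
  rel u v w a := by rw [smul_sub, smul_sub, hc.rel, hd.rel]

theorem IsCoc.codRestrict {c : (Fin (m + 2) →₀ ℕ) → A} (hc : IsCoc m n c) (V : AddSubgroup A)
    (hV : ∀ a, c a ∈ V) : IsCoc m n fun a => (⟨c a, hV a⟩ : V) where
  symm e a := Subtype.ext (hc.symm e a)
  homog a ha := hc.homog a fun h => ha (Subtype.ext h)
  rel u v w a := Subtype.ext (hc.rel u v w a)

variable (A m n) in
/-- The tensors whose coefficients satisfy the conditions of a cocycle. -/
def coeffCocycles : AddSubgroup (A ⊗[ℤ] MvPolynomial (Fin (m + 2)) ℤ) where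
  carrier := {t | IsCoc m n fun a => tcoeff A a t}
  zero_mem' := by
    refine ⟨fun e a => ?_, fun a ha => absurd (map_zero _) ha, fun u v w a => ?_⟩ <;>
    simp only [map_zero, smul_zero]
  add_mem' {x y} hx hy := by
    have := hx.sub (hy.map (-AddMonoidHom.id A))
    simpa only [Set.mem_ofPred_eq, map_add, AddMonoidHom.neg_apply, AddMonoidHom.id_apply,
      sub_neg_eq_add] using this
  neg_mem' {x} hx := by
    have := hx.map (-AddMonoidHom.id A)
    simpa only [Set.mem_ofPred_eq, map_neg, AddMonoidHom.neg_apply, AddMonoidHom.id_apply] using this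

end

theorem ListsIndecomposables.basis_zmod {p m n : ℕ} (hp : p.Prime) {ι : Type*}
    {β : ι → MvPolynomial (Fin (m + 2)) (ZMod p)}
    (hβ : ListsIndecomposables (ZMod p) (m + 2) n β) :
    LinearIndependent (ZMod p) β ∧
      Submodule.span (ZMod p) (Set.range β) = cocycles (ZMod p) (m + 2) n := by
  have := Fact.mk hp
  exact ListsIndecomposables.basis hβ

theorem span_zeta_eq (m n : ℕ) :
    Submodule.span ℚ {map (Int.castRingHom ℚ) (zeta (m + 2) n)} = cocycles ℚ (m + 2) n := by
  have hz := isCoc_zeta m n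
  apply le_antisymm
  · rw [Submodule.span_singleton_le_iff_mem, mem_cocycles_iff]
    simp only [coeff_map]
    exact hz.map (Int.castRingHom ℚ).toAddMonoidHom
  · intro f hf
    rw [Submodule.mem_span_singleton]
    rcases eq_or_ne f 0 with rfl | hf0
    · exact ⟨0, zero_smul _ _⟩
    have hc := mem_cocycles_iff.1 hf
    obtain ⟨a, ha⟩ := exists_coeff_ne_zero hf0
    have hza : ((coeff a (zeta (m + 2) n) : ℤ) : ℚ) ≠ 0 :=
      Int.cast_ne_zero.2 (coeff_zeta_ne_zero (hc.coeff_zetaSum_ne_zero ha))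
    refine ⟨coeff a f / (coeff a (zeta (m + 2) n) : ℤ), ?_⟩
    ext b
    -- Any prime would do, since nonzero integers are invertible in `ℚ`.
    obtain ⟨l, hl, h⟩ := hc.exists_coprime hz (p := 2) a b
    have hl0 : l * 2 ≠ 0 := by
      rintro h0
      rw [Nat.mul_eq_zero, or_iff_left two_ne_zero] at h0
      simp [h0] at hl
    have h1 := (smul_eq_zero.1 h).resolve_left hl0
    rw [zsmul_eq_mul, zsmul_eq_mul, sub_eq_zero] at h1
    rw [coeff_smul, coeff_map, smul_eq_mul, div_mul_eq_mul_div, div_eq_iff hza, mul_comm (coeff b f),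
      ← h1, mul_comm]
    rfl

section

variable {A : Type*} [AddCommGroup A]

theorem tmul_eq_zero_of_map_eq_zero {k p : ℕ} {x : A} (hx : p • x = 0) {g : MvPolynomial (Fin k) ℤ}
    (hg : map (Int.castRingHom (ZMod p)) g = 0) : x ⊗ₜ[ℤ] g = 0 := by
  obtain ⟨h, rfl⟩ := (C_dvd_iff_zmod p g).2 hg
  rw [← smul_eq_C_mul, ← TensorProduct.smul_tmul, natCast_zsmul, hx, TensorProduct.zero_tmul]

theorem tmul_mem_of_map_mem_span {k p : ℕ} [Fact p.Prime] {ι : Type*}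
    {β : ι → MvPolynomial (Fin k) ℤ} (S : AddSubgroup (A ⊗[ℤ] MvPolynomial (Fin k) ℤ)) {x : A}
    (hx : p • x = 0) (hS : ∀ i, x ⊗ₜ[ℤ] β i ∈ S) (g : MvPolynomial (Fin k) ℤ)
    (hg : map (Int.castRingHom (ZMod p)) g ∈
      Submodule.span (ZMod p) (Set.range fun i => map (Int.castRingHom (ZMod p)) (β i))) :
    x ⊗ₜ[ℤ] g ∈ S := by
  have key : ∀ g h : MvPolynomial (Fin k) ℤ,
      map (Int.castRingHom (ZMod p)) g = map (Int.castRingHom (ZMod p)) h →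
      x ⊗ₜ[ℤ] h ∈ S → x ⊗ₜ[ℤ] g ∈ S := by
    intro g h hgh hh
    rw [← sub_eq_zero, ← map_sub] at hgh
    have := tmul_eq_zero_of_map_eq_zero hx hgh
    rw [TensorProduct.tmul_sub, sub_eq_zero] at this
    rwa [this]
  have hsurj : Function.Surjective (map (σ := Fin k) (Int.castRingHom (ZMod p))) :=
    map_surjective _ (ZMod.ringHom_surjective _)
  generalize hg' : map (Int.castRingHom (ZMod p)) g = g' at hg
  induction hg using Submodule.span_induction generalizing g with
  | mem g' h =>
    obtain ⟨i, rfl⟩ := h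
    exact key _ _ hg' (hS i)
  | zero => exact key g 0 (by rw [hg', map_zero]) (by rw [TensorProduct.tmul_zero]; exact S.zero_mem)
  | add g₁ g₂ _ _ h₁ h₂ =>
    obtain ⟨f₁, rfl⟩ := hsurj g₁
    obtain ⟨f₂, rfl⟩ := hsurj g₂
    refine key g (f₁ + f₂) (by rw [hg', map_add]) ?_
    rw [TensorProduct.tmul_add]
    exact S.add_mem (h₁ _ rfl) (h₂ _ rfl)
  | smul r g₁ _ h₁ =>
    obtain ⟨f₁, rfl⟩ := hsurj g₁
    obtain ⟨r, rfl⟩ := ZMod.intCast_surjective r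
    refine key g (r • f₁) ?_ ?_
    · rw [hg', map_zsmul, Int.cast_smul_eq_zsmul]
    · rw [TensorProduct.tmul_smul]
      exact S.zsmul_mem (h₁ _ rfl) r

theorem exists_eq_sum_smul (K : Type*) {V : Type*} [Field K] [AddCommGroup V] [Module K V]
    (t : Finset V) : ∃ (J : Finset (Module.Basis.ofVectorSpaceIndex K V))
      (φ : Module.Basis.ofVectorSpaceIndex K V → V →+ K),
      ∀ x ∈ t, x = ∑ j ∈ J, φ j x • (j : V) := by
  classical
  let b := Module.Basis.ofVectorSpace K V
  refine ⟨t.biUnion fun x => (b.repr x).support, fun j => (b.coord j).toAddMonoidHom, fun x hx => ?_⟩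
  conv_lhs => rw [← b.linearCombination_repr x]
  rw [Finsupp.linearCombination_apply, Finsupp.sum_of_support_subset _
    (Finset.subset_biUnion_of_mem (fun x => (b.repr x).support) hx) _ (by simp)]
  exact Finset.sum_congr rfl fun j _ => by rw [Module.Basis.ofVectorSpace_apply_self]; rfl

/-- The coefficients lie in the `𝔽_p`-space `V = A[p]`. Each coordinate in a basis of `V` is a
cocycle over `𝔽_p`, and tensoring with an element of `V` depends only on the reduction modulo `p`,
so integral lifts may be chosen freely. -/
theorem mem_of_prime_nsmul_eq_zero {m n p : ℕ} [hp : Fact p.Prime] {ι : Type*}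
    {β : ι → MvPolynomial (Fin (m + 2)) ℤ}
    (hβ : Submodule.span (ZMod p) (Set.range fun i => map (Int.castRingHom (ZMod p)) (β i)) =
      cocycles (ZMod p) (m + 2) n)
    (S : AddSubgroup (A ⊗[ℤ] MvPolynomial (Fin (m + 2)) ℤ))
    (hS : ∀ i, ∀ x : A, p • x = 0 → x ⊗ₜ[ℤ] β i ∈ S)
    {f : A ⊗[ℤ] MvPolynomial (Fin (m + 2)) ℤ} (hf : IsCoc m n fun a => tcoeff A a f)
    (hpf : p • f = 0) : f ∈ S := by
  classical
  obtain ⟨s, hs⟩ := exists_sum_tcoeff f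
  replace hs := hs s subset_rfl
  have hs0 : ∀ a ∉ s, tcoeff A a f = 0 := by
    intro a ha
    rw [hs, map_sum]
    refine Finset.sum_eq_zero fun b hb => ?_
    rw [tcoeff_tmul, coeff_monomial, if_neg (ne_of_mem_of_not_mem hb ha), zero_smul]
  let V : AddSubgroup A := (nsmulAddMonoidHom p : A →+ A).ker
  have hcV : ∀ a, tcoeff A a f ∈ V := fun a => by
    rw [AddMonoidHom.mem_ker, nsmulAddMonoidHom_apply, ← map_nsmul, hpf, map_zero]
  let c' : (Fin (m + 2) →₀ ℕ) → V := fun a => ⟨tcoeff A a f, hcV a⟩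
  have hc' : IsCoc m n c' := hf.codRestrict V hcV
  let _ : Module (ZMod p) V := AddCommGroup.zmodModule fun x => Subtype.ext x.2
  obtain ⟨J, φ, hφ⟩ := exists_eq_sum_smul (ZMod p) (s.image c')
  let g : Module.Basis.ofVectorSpaceIndex (ZMod p) V → MvPolynomial (Fin (m + 2)) ℤ := fun j =>
    ∑ a ∈ s, monomial a ((φ j (c' a)).val : ℤ)
  have hg : ∀ j, map (Int.castRingHom (ZMod p)) (g j) ∈ cocycles (ZMod p) (m + 2) n := by
    intro j
    rw [mem_cocycles_iff]
    convert hc'.map (φ j) using 2 with a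
    rw [coeff_map, coeff_sum]
    simp only [coeff_monomial, Finset.sum_ite_eq']
    split_ifs with ha
    · simp
    · have : c' a = 0 := Subtype.ext (hs0 a ha)
      simp [this]
  have hsum : f = ∑ j ∈ J, ((j : V) : A) ⊗ₜ[ℤ] g j := by
    simp only [g, TensorProduct.tmul_sum]
    rw [Finset.sum_comm]
    conv_lhs => rw [hs]
    refine Finset.sum_congr rfl fun a ha => ?_
    have h2 : tcoeff A a f = ∑ j ∈ J, (φ j (c' a)).val • ((j : V) : A) := by
      have := congrArg V.subtype (hφ (c' a) (Finset.mem_image_of_mem c' ha))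
      rw [map_sum] at this
      refine this.trans (Finset.sum_congr rfl fun j _ => ?_)
      conv_lhs => rw [← ZMod.natCast_zmod_val (φ j (c' a)), Nat.cast_smul_eq_nsmul]
      rw [map_nsmul]
      rfl
    rw [h2, TensorProduct.sum_tmul]
    refine Finset.sum_congr rfl fun j _ => ?_
    rw [← natCast_zsmul, TensorProduct.smul_tmul, smul_monomial, smul_eq_mul, mul_one]
  rw [hsum]
  refine S.sum_mem fun j _ => ?_
  have hbj : p • ((j : V) : A) = 0 := (j : V).2
  exact tmul_mem_of_map_mem_span S hbj (fun i => hS i _ hbj) _ (hβ ▸ hg j)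

theorem mem_of_squarefree_nsmul_eq_zero {M : Type*} [AddCommGroup M] (S T : AddSubgroup M)
    (hS : ∀ p : ℕ, p.Prime → ∀ f ∈ T, p • f = 0 → f ∈ S) (N : ℕ) (hN : Squarefree N) (f : M)
    (hf : f ∈ T) (hNf : N • f = 0) : f ∈ S := by
  induction N using Nat.strong_induction_on generalizing f with
  | _ N ih =>
  rcases eq_or_ne N 1 with rfl | hN1
  · rw [one_nsmul] at hNf
    rw [hNf]
    exact S.zero_mem
  have hp := Nat.minFac_prime hN1
  obtain ⟨L, hL⟩ := Nat.minFac_dvd N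
  generalize N.minFac = p at hp hL
  subst hL
  have hcop : Nat.Coprime p L := Nat.coprime_of_squarefree_mul hN
  have hL0 : 0 < L := Nat.pos_of_ne_zero fun h => hN.ne_zero (by rw [h, mul_zero])
  have h1 : p • f ∈ S := ih L (by nlinarith [hp.two_le]) (hN.of_mul_right) _ (T.nsmul_mem hf p) (by
    rwa [smul_smul, mul_comm])
  have h2 : L • f ∈ S := hS p hp _ (T.nsmul_mem hf L) (by rwa [smul_smul])
  have h3 := Nat.gcd_eq_gcd_ab p L
  rw [Nat.Coprime.gcd_eq_one hcop] at h3
  have h4 : f = p.gcdA L • (p • f) + p.gcdB L • (L • f) := by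
    rw [← natCast_zsmul f p, ← natCast_zsmul f L, smul_smul, smul_smul, ← add_smul,
      mul_comm _ (p : ℤ), mul_comm _ (L : ℤ), ← h3, Nat.cast_one, one_zsmul]
  rw [h4]
  exact S.add_mem (S.zsmul_mem h1 _) (S.zsmul_mem h2 _)

theorem exists_coprime_sum {α M : Type*} [AddCommGroup M] {p : ℕ} (t : Finset α) (g : α → M)
    (h : ∀ i ∈ t, ∃ l : ℕ, l.Coprime p ∧ (l * p) • g i = 0) :
    ∃ l : ℕ, l.Coprime p ∧ (l * p) • ∑ i ∈ t, g i = 0 := by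
  classical
  induction t using Finset.induction_on with
  | empty => exact ⟨1, Nat.coprime_one_left p, by simp⟩
  | insert i t hi ih =>
    obtain ⟨l, hl, h1⟩ := ih fun j hj => h j (Finset.mem_insert_of_mem hj)
    obtain ⟨l', hl', h2⟩ := h i (Finset.mem_insert_self i t)
    refine ⟨l * l', hl.mul_left hl', ?_⟩
    rw [Finset.sum_insert hi, smul_add, mul_assoc, mul_smul, h2, smul_zero, zero_add,
      mul_left_comm, mul_smul, h1, smul_zero]

theorem IsTensorCocycle.exists_sub_zeta {m n : ℕ} {f : A ⊗[ℤ] MvPolynomial (Fin (m + 2)) ℤ}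
    (hf : IsTensorCocycle A (m + 2) n f) :
    ∃ b : A, IsCoc m n (fun a => tcoeff A a (f - b ⊗ₜ[ℤ] zeta (m + 2) n)) ∧
      ∃ N : ℕ, Squarefree N ∧ N • (f - b ⊗ₜ[ℤ] zeta (m + 2) n) = 0 := by
  have hc := hf.isCoc
  have hz := isCoc_zeta m n
  have hcoc : ∀ b : A, IsCoc m n (fun a => tcoeff A a (f - b ⊗ₜ[ℤ] zeta (m + 2) n)) := by
    intro b
    simp only [map_sub, tcoeff_tmul]
    exact hc.sub (hz.map ((zmultiplesHom A) b))
  obtain ⟨s, hs⟩ := exists_sum_tcoeff f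
  by_cases h0 : ∀ a, tcoeff A a f = 0
  · refine ⟨0, hcoc 0, 1, squarefree_one, ?_⟩
    rw [TensorProduct.zero_tmul, sub_zero, one_nsmul, hs s subset_rfl]
    exact Finset.sum_eq_zero fun a _ => by rw [h0, TensorProduct.zero_tmul]
  push Not at h0
  obtain ⟨a₀, ha₀⟩ := h0
  obtain ⟨r, hr⟩ := exists_bezout_zeta (k := m + 2) (n := n) fun h =>
    hc.coeff_zetaSum_ne_zero ha₀ (by rw [h, coeff_zero])
  -- If `f` were `b' ⊗ ζ`, the Bezout relation would make this sum equal to `b'`. In general the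
  -- error is the combination of cross differences in `hcoeff`.
  let b : A := ∑ y ∈ (zetaSum (m + 2) n).support, r y • tcoeff A y f
  refine ⟨b, hcoc b, ?_⟩
  set f' := f - b ⊗ₜ[ℤ] zeta (m + 2) n with hf'
  have hcoeff : ∀ x, tcoeff A x f' = ∑ y ∈ (zetaSum (m + 2) n).support,
      r y • (coeff y (zeta (m + 2) n) • tcoeff A x f - coeff x (zeta (m + 2) n) • tcoeff A y f) := by
    intro x
    simp only [smul_sub, Finset.sum_sub_distrib, smul_smul]
    rw [← Finset.sum_smul, hr, one_zsmul, hf', map_sub, tcoeff_tmul, Finset.smul_sum]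
    simp only [smul_smul, mul_comm]
  have key : ∀ p : ℕ, p.Prime → ∃ l : ℕ, l.Coprime p ∧ (l * p) • f' = 0 := by
    intro p hp
    have := Fact.mk hp
    obtain ⟨t, ht⟩ := exists_sum_tcoeff f'
    rw [ht t subset_rfl]
    refine exists_coprime_sum _ _ fun x _ => ?_
    obtain ⟨l, hl, h⟩ : ∃ l : ℕ, l.Coprime p ∧ (l * p) • tcoeff A x f' = 0 := by
      rw [hcoeff]
      refine exists_coprime_sum _ _ fun y _ => ?_
      obtain ⟨l, hl, h⟩ := hc.exists_coprime hz (p := p) x y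
      exact ⟨l, hl, by rw [smul_comm, h, smul_zero]⟩
    exact ⟨l, hl, by rw [← natCast_zsmul, TensorProduct.smul_tmul', natCast_zsmul, h,
      TensorProduct.zero_tmul]⟩
  -- Infinite order is excluded as well: `addOrderOf` would be 0, which is divisible by `p * p`.
  refine ⟨addOrderOf f', ?_, addOrderOf_nsmul_eq_zero f'⟩
  rw [Nat.squarefree_iff_prime_squarefree]
  intro p hp hdvd
  obtain ⟨l, hl, h⟩ := key p hp
  have := hdvd.trans (addOrderOf_dvd_of_nsmul_eq_zero h)
  exact (hp.coprime_iff_not_dvd.1 hl.symm) (Nat.dvd_of_mul_dvd_mul_right hp.pos this)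

theorem exists_finsupp_of_mem_closure {k : ℕ} {κ : Nat.Primes → Type*}
    (β : ∀ p : Nat.Primes, κ p → MvPolynomial (Fin k) ℤ) {t : A ⊗[ℤ] MvPolynomial (Fin k) ℤ}
    (ht : t ∈ AddSubgroup.closure {t | ∃ (p : Nat.Primes) (i : κ p) (x : A), (p : ℕ) • x = 0 ∧
      t = x ⊗ₜ[ℤ] β p i}) :
    ∃ c : (Σ p : Nat.Primes, κ p) →₀ A,
      (∀ i, (i.1 : ℕ) • c i = 0) ∧ t = c.sum fun i a => a ⊗ₜ[ℤ] β i.1 i.2 := by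
  induction ht using AddSubgroup.closure_induction with
  | mem t h =>
    classical
    obtain ⟨p, i, x, hx, rfl⟩ := h
    refine ⟨Finsupp.single ⟨p, i⟩ x, fun j => ?_, ?_⟩
    · rw [Finsupp.single_apply]
      split_ifs with hj
      · rw [← hj]
        exact hx
      · exact smul_zero _
    · exact (Finsupp.sum_single_index (a := (⟨p, i⟩ : Σ p : Nat.Primes, κ p)) (b := x)
        (h := fun i a => a ⊗ₜ[ℤ] β i.1 i.2) (TensorProduct.zero_tmul _ _)).symm
  | zero => exact ⟨0, fun _ => smul_zero _, Finsupp.sum_zero_index.symm⟩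
  | add t t' _ _ h h' =>
    obtain ⟨c, hc, rfl⟩ := h
    obtain ⟨c', hc', rfl⟩ := h'
    refine ⟨c + c', fun i => by rw [Finsupp.add_apply, smul_add, hc, hc', add_zero], ?_⟩
    exact (Finsupp.sum_add_index' (h := fun (i : Σ p : Nat.Primes, κ p) (a : A) =>
      a ⊗ₜ[ℤ] β i.1 i.2) (fun _ => TensorProduct.zero_tmul _ _)
      fun _ _ _ => TensorProduct.add_tmul _ _ _).symm
  | neg t _ h =>
    obtain ⟨c, hc, rfl⟩ := h
    refine ⟨-c, fun i => by rw [Finsupp.neg_apply, smul_neg, hc, neg_zero], ?_⟩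
    refine Eq.trans ?_ (Finsupp.sum_neg_index (h := fun (i : Σ p : Nat.Primes, κ p) (a : A) =>
      a ⊗ₜ[ℤ] β i.1 i.2) (fun _ => TensorProduct.zero_tmul _ _)).symm
    rw [Finsupp.sum, Finsupp.sum, ← Finset.sum_neg_distrib]
    exact Finset.sum_congr rfl fun i _ => (TensorProduct.neg_tmul _ _).symm

end

end SymmCocycle

theorem mainTheorem4 (k n : ℕ) (hk : 2 ≤ k)
    (ι : Nat.Primes → Type*) (β : ∀ p : Nat.Primes, ι p → MvPolynomial (Fin k) ℤ)
    (hβ : ∀ p : Nat.Primes, SymmCocycle.ListsIndecomposables (ZMod p) k n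
      (fun i => MvPolynomial.map (Int.castRingHom (ZMod p)) (β p i))) :
    (∀ p : Nat.Primes,
      LinearIndependent (ZMod p)
        (fun i => MvPolynomial.map (Int.castRingHom (ZMod p)) (β p i)) ∧
      Submodule.span (ZMod p)
        (Set.range fun i => MvPolynomial.map (Int.castRingHom (ZMod p)) (β p i))
          = SymmCocycle.cocycles (ZMod p) k n) ∧
    Submodule.span ℚ {MvPolynomial.map (Int.castRingHom ℚ) (SymmCocycle.zeta k n)}
      = SymmCocycle.cocycles ℚ k n ∧
    ∀ (A : Type*) [AddCommGroup A] (f : A ⊗[ℤ] MvPolynomial (Fin k) ℤ),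
      SymmCocycle.IsTensorCocycle A k n f →
      ∃ (b : A) (c : (Σ p : Nat.Primes, ι p) →₀ A),
        (∀ i, (i.1 : ℕ) • c i = 0) ∧
        f = b ⊗ₜ[ℤ] SymmCocycle.zeta k n + c.sum (fun i a => a ⊗ₜ[ℤ] β i.1 i.2) := by
  obtain ⟨m, rfl⟩ := Nat.exists_eq_add_of_le' hk
  have hbasis := fun p : Nat.Primes => (hβ p).basis_zmod p.2
  refine ⟨hbasis, SymmCocycle.span_zeta_eq m n, fun A _ f hf => ?_⟩
  obtain ⟨b, hcoc, N, hN, hNf⟩ := hf.exists_sub_zeta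
  have hmem := SymmCocycle.mem_of_squarefree_nsmul_eq_zero (AddSubgroup.closure
    {t | ∃ (p : Nat.Primes) (i : ι p) (x : A), (p : ℕ) • x = 0 ∧ t = x ⊗ₜ[ℤ] β p i})
    (SymmCocycle.coeffCocycles A m n) (fun p hp g hg hpg => by
      have := Fact.mk hp
      exact SymmCocycle.mem_of_prime_nsmul_eq_zero (hbasis ⟨p, hp⟩).2 _
        (fun i x hx => by exact AddSubgroup.subset_closure ⟨⟨p, hp⟩, i, x, hx, rfl⟩) hg hpg)
    N hN _ hcoc hNf
  obtain ⟨c, hc, h⟩ := SymmCocycle.exists_finsupp_of_mem_closure β hmem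
  exact ⟨b, c, hc, by rw [← h, add_sub_cancel]⟩
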